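/- **Setting.** Let $\Omega\subseteq\mathbb R^n$ be open and $1<p<\infty$. A *weight vector* is $\Lambda=(\lambda_1,\dots,\lambda_n)$ with positive continuous $\lambda_j:\mathbb R^n\to\mathbb R$ such that, for some constants $C,c>0$ and all $j$: $c\langle\xi\rangle^c\le\lambda_j(\xi)\le C\langle\xi\rangle^C$, where $\langle\xi\rangle=\sqrt{1+|\xi|^2}$; $\lambda_j(\xi)\ge c|\xi_j|$; and $c\le\lambda_j(\eta)/\lambda_j(\xi)\le C$ whenever $\sum_k|\xi_k-\eta_k|\lambda_k(\eta)^{-1}\le c$. An *admissible weight* associated to $\Lambda$ is a positive continuous $m:\mathbb R^n\to\mathbb R$ such that, for some $N,C,c>0$, $m(\eta)\le C\,m(\xi)(1+|\eta-\xi|)^N$ for all $\xi,\eta$, and $c\le m(\eta)/m(\xi)\le C$ whenever $\sum_k|\xi_k-\eta_k|\lambda_k(\eta)^{-1}\le c$. The symbol class $S_{m,\Lambda}(\Omega)$ consists of all $a\in C^\infty(\Omega\times\mathbb R^n)$ such that for every compact $K\subset\Omega$ and all multi-indices $\alpha,\beta$ there is $c_{\alpha,\beta,K}>0$ with $\sup_{x\in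 K}|\partial_\xi^\alpha\partial_x^\beta a(x,\xi)|\le c_{\alpha,\beta,K}\,m(\xi)\prod_k\lambda_k(\xi)^{-\alpha_k}$ for all $\xi\in\mathbb R^n$. For $u\in C_0^\infty(\Omega)$ put $$a(x,D)u(x)=(2\pi)^{-n}\int e^{ix\cdot\xi}a(x,\xi)\hat u(\xi)\,d\xi,\qquad \hat u(\xi)=\int e^{-iy\cdot\xi}u(y)\,dy .$$ The operator $a(x,D)$ is *properly supported* in $\Omega$ if both projections to $\Omega$ of the support of its distribution kernel are proper maps, that is, for every compact $K\subset\Omega$ there is a compact $K'\subset\Omega$ such that, for $u\in C_0^\infty(\Omega)$, $\operatorname{supp}u\subset K$ implies $\operatorname{supp}a(x,D)u\subset K'$, and $u=0$ on $K'$ implies $a(x,D)u=0$ on $K$. $L^p_{\rm loc}(\Omega)$ denotes the Fréchet space defined by the seminorms $\|u\|_{L^p(K)}$, $K\subset\Omega$ compact, and $(f,g)=\int_\Omega f\bar g$, $\langle f,g\rangle=\int_\Omega fg$. Each $\varphi\in C_0^\infty(\Omega)$ is identified with the element $u\mapsto\langle u,\varphi\rangle$ of $(L^p_{\rm loc}(\Omega))'$.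 The dual $T'$ of a densely defined operator $T$ in $L^p_{\rm loc}(\Omega)$ has as domain $D(T')$ the set of all $y'\in(L^p_{\rm loc}(\Omega))'$ for which there is $x'\in(L^p_{\rm loc}(\Omega))'$ with $\langle Tu,y'\rangle=\langle u,x'\rangle$ for all $u\in D(T)$, and $T'y'=x'$. Let $\Lambda$ be a weight vector, $m$ an admissible weight associated to $\Lambda$ with $m(\xi)\ge c>0$ for all $\xi$ and some constant $c$, and $a\in S_{m,\Lambda}(\Omega)$ such that $a(x,D)$ is properly supported. Let $T_a=a(x,D)$, as an operator in $L^p_{\rm loc}(\Omega)$ with domain $C_0^\infty(\Omega)$, and let $T_a^*\psi\in C_0^\infty(\Omega)$ be determined by $(T_a\varphi,\psi)=(\varphi,T_a^*\psi)$ for all $\varphi\in C_0^\infty(\Omega)$, for each $\psi\in C_0^\infty(\Omega)$. The *minimal extension* $T_{a,0}$ is the smallest closed extension of $T_a$. The *maximal extension* $T_{a,1}$ has as domain all $u\in L^p_{\rm loc}(\Omega)$ for which there is $f\in L^p_{\rm loc}(\Omega)$ with $(u,T_a^*\varphi)=(f,\varphi)$ for all $\varphi\in C_0^\infty(\Omega)$,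 and $T_{a,1}u=f$. **Proposition.** Under these assumptions: 1. $C_0^\infty(\Omega)\subset D(T_{a,1}')$; 2. $T_{a,1}$ is an extension of $T_{a,0}$; 3. $T_{a,1}$ is the largest closed extension of $T_a$ whose dual has $C_0^\infty(\Omega)$ in its domain: $T_{a,1}$ is a closed extension of $T_a$ with $C_0^\infty(\Omega)\subset D(T_{a,1}')$, and it extends every closed extension $B$ of $T_a$ with $C_0^\infty(\Omega)\subset D(B')$. -/

import Mathlib

open MeasureTheory TopologicalSpace Set Filter
open scoped ENNReal ContDiff Distributions ComplexConjugate Topology InnerProductSpace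

noncomputable section

namespace MPseudo

/-- The Euclidean space `ℝⁿ`. -/
abbrev RSp (n : ℕ) : Type := EuclideanSpace ℝ (Fin n)

variable {n : ℕ}

/-! ### Weights and symbols -/

/-- The Japanese bracket `⟨ξ⟩ = √(1 + |ξ|²)`. -/
def bracket (ξ : RSp n) : ℝ := Real.sqrt (1 + ‖ξ‖ ^ 2)

/-- `Λ = (λ₁, …, λₙ)` is a weight vector: positive continuous components with polynomial growth,
the M-condition `λⱼ(ξ) ≥ c |ξⱼ|` and the slowly varying condition. -/
structure IsWeightVector (Λ : Fin n → RSp n → ℝ) : Prop where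
  pos : ∀ j ξ, 0 < Λ j ξ
  continuous : ∀ j, Continuous (Λ j)
  bounds : ∃ C > (0 : ℝ), ∃ c > (0 : ℝ), ∀ j : Fin n,
    (∀ ξ, c * bracket ξ ^ c ≤ Λ j ξ ∧ Λ j ξ ≤ C * bracket ξ ^ C) ∧
    (∀ ξ, c * |ξ j| ≤ Λ j ξ) ∧
    (∀ ξ η, ∑ k, |ξ k - η k| * (Λ k η)⁻¹ ≤ c → c ≤ Λ j η / Λ j ξ ∧ Λ j η / Λ j ξ ≤ C)

/-- `m` is an admissible weight associated to `Λ`: positive, continuous, temperate, and slowly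
varying with respect to `Λ`. -/
structure IsAdmissibleWeight (Λ : Fin n → RSp n → ℝ) (m : RSp n → ℝ) : Prop where
  pos : ∀ ξ, 0 < m ξ
  continuous : Continuous m
  bounds : ∃ N > (0 : ℝ), ∃ C > (0 : ℝ), ∃ c > (0 : ℝ),
    (∀ ξ η, m η ≤ C * m ξ * (1 + ‖η - ξ‖) ^ N) ∧
    (∀ ξ η, ∑ k, |ξ k - η k| * (Λ k η)⁻¹ ≤ c → c ≤ m η / m ξ ∧ m η / m ξ ≤ C)

/-- The partial derivative `∂_{x_j}` of a function of `(x, ξ)`. -/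
def partialX (j : Fin n) (a : RSp n × RSp n → ℂ) : RSp n × RSp n → ℂ :=
  fun z => fderiv ℝ a z (EuclideanSpace.single j (1 : ℝ), 0)

/-- The partial derivative `∂_{ξ_j}` of a function of `(x, ξ)`. -/
def partialXi (j : Fin n) (a : RSp n × RSp n → ℂ) : RSp n × RSp n → ℂ :=
  fun z => fderiv ℝ a z (0, EuclideanSpace.single j (1 : ℝ))

/-- `∂_x^β a` for a multi-index `β`. -/
def multiX (β : Fin n → ℕ) (a : RSp n × RSp n → ℂ) : RSp n × RSp n → ℂ :=
  (List.finRange n).foldr (fun j g => (partialX j)^[β j] g) a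

/-- `∂_ξ^α a` for a multi-index `α`. -/
def multiXi (α : Fin n → ℕ) (a : RSp n × RSp n → ℂ) : RSp n × RSp n → ℂ :=
  (List.finRange n).foldr (fun j g => (partialXi j)^[α j] g) a

/-- The symbol class `S_{m,Λ}(Ω)`. A symbol is a function on `ℝⁿ × ℝⁿ` of which only the values on
`Ω × ℝⁿ` matter: `a ∈ C^∞(Ω × ℝⁿ)` and
`sup_{x ∈ K} |∂_ξ^α ∂_x^β a(x, ξ)| ≤ c_{α,β,K} m(ξ) Λ(ξ)^{-α}` for every compact `K ⊆ Ω`. -/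
structure IsSymbol (Ω : Opens (RSp n)) (m : RSp n → ℝ) (Λ : Fin n → RSp n → ℝ)
    (a : RSp n × RSp n → ℂ) : Prop where
  smooth : ContDiffOn ℝ ∞ a ((Ω : Set (RSp n)) ×ˢ univ)
  bound : ∀ K : Set (RSp n), IsCompact K → K ⊆ Ω → ∀ α β : Fin n → ℕ, ∃ C > (0 : ℝ),
    ∀ x ∈ K, ∀ ξ, ‖multiXi α (multiX β a) (x, ξ)‖ ≤ C * m ξ * (∏ k, Λ k ξ ^ α k)⁻¹

/-! ### Pseudodifferential operators on test functions -/

/-- The Fourier transform `û(ξ) = ∫ e^{-i y·ξ} u(y) dy`. -/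
def hat (u : RSp n → ℂ) (ξ : RSp n) : ℂ :=
  ∫ y, Complex.exp (-(Complex.I * (⟪y, ξ⟫_ℝ : ℝ))) * u y

/-- The pseudodifferential operator
`a(x, D)u (x) = (2π)^{-n} ∫ e^{i x·ξ} a(x, ξ) û(ξ) dξ`. -/
def pdo (a : RSp n × RSp n → ℂ) (u : RSp n → ℂ) (x : RSp n) : ℂ :=
  (((2 * Real.pi) ^ n : ℝ) : ℂ)⁻¹ *
    ∫ ξ, Complex.exp (Complex.I * (⟪x, ξ⟫_ℝ : ℝ)) * a (x, ξ) * hat u ξ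

/-- `a(x, D)` is properly supported in `Ω`: both projections of the support of its distribution
kernel to `Ω` are proper maps, that is, every compact `K ⊆ Ω` admits a compact `K' ⊆ Ω` such that
`supp u ⊆ K` implies `supp a(x, D)u ⊆ K'`, and `u = 0` on `K'` implies `a(x, D)u = 0` on `K`. -/
def IsProperlySupported (Ω : Opens (RSp n)) (a : RSp n × RSp n → ℂ) : Prop :=
  ∀ K : Set (RSp n), IsCompact K → K ⊆ Ω → ∃ K' : Set (RSp n), IsCompact K' ∧ K' ⊆ Ω ∧
    (∀ u : 𝓓(Ω, ℂ), tsupport u ⊆ K → ∀ x ∈ Ω, x ∉ K' → pdo a u x = 0) ∧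
    (∀ u : 𝓓(Ω, ℂ), (∀ y ∈ K', u y = 0) → ∀ x ∈ K, pdo a u x = 0)

/-- The sesquilinear pairing `(f, g) = ∫_Ω f ḡ`. -/
def sesq (Ω : Opens (RSp n)) (f g : RSp n → ℂ) : ℂ := ∫ x in (Ω : Set (RSp n)), f x * conj (g x)

open scoped Classical in
/-- The (formal) adjoint `a(x, D)*` on test functions: `a(x, D)* ψ` is the test function `g`
determined by `(a(x, D)φ, ψ) = (φ, g)` for all `φ ∈ C₀^∞(Ω)`. (For symbols of properly supported
operators it exists for every `ψ`; the value `0` is used if there is no such `g`.) -/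
def formalAdjoint (Ω : Opens (RSp n)) (a : RSp n × RSp n → ℂ) (ψ : 𝓓(Ω, ℂ)) : 𝓓(Ω, ℂ) :=
  if h : ∃ g : 𝓓(Ω, ℂ), ∀ φ : 𝓓(Ω, ℂ), sesq Ω (pdo a φ) ψ = sesq Ω φ g then h.choose else 0

/-! ### The Fréchet space `L^p_loc(Ω)` -/

/-- Classes of a.e. equal functions on `Ω` that are in `L^p(K)` for every compact `K ⊆ Ω`. -/
def lpLocSubmodule (Ω : Opens (RSp n)) (p : ℝ≥0∞) :
    Submodule ℂ (RSp n →ₘ[volume.restrict (Ω : Set (RSp n))] ℂ) where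
  carrier := {f | ∀ K : Set (RSp n), IsCompact K → K ⊆ Ω → MemLp f p (volume.restrict K)}
  zero_mem' := fun _ _ hK => by
    refine (memLp_congr_ae ?_).2 MemLp.zero
    exact ae_mono (Measure.restrict_mono hK le_rfl) AEEqFun.coeFn_zero
  add_mem' := fun {f g} hf hg K hc hK => by
    refine (memLp_congr_ae ?_).2 ((hf K hc hK).add (hg K hc hK))
    exact ae_mono (Measure.restrict_mono hK le_rfl) (AEEqFun.coeFn_add f g)
  smul_mem' := fun c f hf K hc hK => by
    refine (memLp_congr_ae ?_).2 ((hf K hc hK).const_smul c)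
    exact ae_mono (Measure.restrict_mono hK le_rfl) (AEEqFun.coeFn_smul c f)

/-- The space `L^p_loc(Ω)`. -/
def LpLoc (Ω : Opens (RSp n)) (p : ℝ≥0∞) : Type := ↥(lpLocSubmodule Ω p)

namespace LpLoc

variable {Ω : Opens (RSp n)} {p : ℝ≥0∞}

instance : AddCommGroup (LpLoc Ω p) := inferInstanceAs (AddCommGroup ↥(lpLocSubmodule Ω p))

instance : Module ℂ (LpLoc Ω p) := inferInstanceAs (Module ℂ ↥(lpLocSubmodule Ω p))

instance : CoeFun (LpLoc Ω p) (fun _ => RSp n → ℂ) := ⟨fun f => (f.1 : RSp n → ℂ)⟩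

theorem memLp (f : LpLoc Ω p) {K : Set (RSp n)} (hc : IsCompact K) (hK : K ⊆ Ω) :
    MemLp f p (volume.restrict K) := f.2 K hc hK

theorem coeFn_add (f g : LpLoc Ω p) :
    ⇑(f + g) =ᵐ[volume.restrict (Ω : Set (RSp n))] fun x => f x + g x :=
  AEEqFun.coeFn_add f.1 g.1

theorem coeFn_smul (c : ℂ) (f : LpLoc Ω p) :
    ⇑(c • f) =ᵐ[volume.restrict (Ω : Set (RSp n))] fun x => c * f x :=
  AEEqFun.coeFn_smul c f.1

theorem coeFn_zero : ⇑(0 : LpLoc Ω p) =ᵐ[volume.restrict (Ω : Set (RSp n))] fun _ => 0 :=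
  AEEqFun.coeFn_zero

theorem ext {f g : LpLoc Ω p} (h : ⇑f =ᵐ[volume.restrict (Ω : Set (RSp n))] ⇑g) : f = g :=
  Subtype.ext (AEEqFun.ext h)

/-- The seminorms `‖f‖_{L^p(K)}`, for `K` ranging over the compact subsets of `Ω`. -/
def seminorms (Ω : Opens (RSp n)) (p : ℝ≥0∞) [Fact (1 ≤ p)] :
    SeminormFamily ℂ (LpLoc Ω p) {K : Compacts (RSp n) // (K : Set (RSp n)) ⊆ Ω} := fun K =>
  Seminorm.of (fun f => (eLpNorm f p (volume.restrict (K.1 : Set (RSp n)))).toReal)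
    (fun f g => by
      have hf := f.memLp K.1.isCompact K.2
      have hg := g.memLp K.1.isCompact K.2
      rw [← ENNReal.toReal_add hf.2.ne hg.2.ne]
      refine ENNReal.toReal_mono (ENNReal.add_ne_top.2 ⟨hf.2.ne, hg.2.ne⟩) ?_
      rw [eLpNorm_congr_ae (ae_mono (Measure.restrict_mono K.2 le_rfl) (coeFn_add f g))]
      exact eLpNorm_add_le hf.1 hg.1 Fact.out)
    (fun c f => by
      rw [eLpNorm_congr_ae (ae_mono (Measure.restrict_mono K.2 le_rfl) (coeFn_smul c f))]
      have := eLpNorm_const_smul c (⇑f) p (volume.restrict (K.1 : Set (RSp n)))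
      change (eLpNorm (c • ⇑f) p _).toReal = _
      rw [this, ENNReal.toReal_mul, toReal_enorm])

variable [Fact (1 ≤ p)]

instance : TopologicalSpace (LpLoc Ω p) := (seminorms Ω p).moduleFilterBasis.topology

theorem withSeminorms : WithSeminorms (seminorms Ω p) where
  topology_eq_withSeminorms := rfl

instance : IsTopologicalAddGroup (LpLoc Ω p) := withSeminorms.topologicalAddGroup

instance : ContinuousSMul ℂ (LpLoc Ω p) := withSeminorms.continuousSMul

end LpLoc

/-! ### Basic facts that make the operators below well defined -/

section aux

variable {Ω : Opens (RSp n)} {p : ℝ≥0∞}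

theorem memLp_of_continuousOn {f : RSp n → ℂ} (hf : ContinuousOn f Ω) {K : Set (RSp n)}
    (hc : IsCompact K) (hK : K ⊆ Ω) : MemLp f p (volume.restrict K) := by
  have hfK := hf.mono hK
  obtain ⟨C, hC⟩ := hc.exists_bound_of_continuousOn hfK
  have : IsFiniteMeasure ((volume : Measure (RSp n)).restrict K) :=
    ⟨by simpa using hc.measure_lt_top⟩
  refine MemLp.of_bound (hfK.aestronglyMeasurable hc.measurableSet) C ?_
  filter_upwards [ae_restrict_mem hc.measurableSet] with x hx using hC x hx

/-- The class in `L^p_loc(Ω)` of a function that is continuous on `Ω`. -/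
def LpLoc.ofContinuousOn (p : ℝ≥0∞) (f : RSp n → ℂ) (hf : ContinuousOn f Ω) : LpLoc Ω p :=
  ⟨AEEqFun.mk f (hf.aestronglyMeasurable Ω.isOpen.measurableSet), fun _ hc hK =>
    (memLp_congr_ae (ae_mono (Measure.restrict_mono hK le_rfl) (AEEqFun.coeFn_mk f _))).2
      (memLp_of_continuousOn hf hc hK)⟩

theorem LpLoc.coeFn_ofContinuousOn (f : RSp n → ℂ) (hf : ContinuousOn f Ω) :
    ⇑(LpLoc.ofContinuousOn p f hf) =ᵐ[volume.restrict (Ω : Set (RSp n))] f :=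
  AEEqFun.coeFn_mk f _

theorem LpLoc.integrable_mul_testFunction [Fact (1 ≤ p)] (u : LpLoc Ω p) {g : RSp n → ℂ}
    (hg : Continuous g) (hc : HasCompactSupport g) (hs : tsupport g ⊆ Ω) :
    Integrable (fun x => u x * g x) (volume.restrict (Ω : Set (RSp n))) := by
  have hK : IsCompact (tsupport g) := hc
  have : IsFiniteMeasure ((volume : Measure (RSp n)).restrict (tsupport g)) :=
    ⟨by simpa using hK.measure_lt_top⟩
  have h1 : Integrable u (volume.restrict (tsupport g)) :=
    memLp_one_iff_integrable.1 ((u.memLp hK hs).mono_exponent Fact.out)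
  obtain ⟨C, hC⟩ := hg.bounded_above_of_compact_support hc
  have h2 : IntegrableOn (fun x => u x * g x) (tsupport g) volume :=
    h1.mul_bdd (c := C) hg.aestronglyMeasurable (ae_of_all _ hC)
  refine (integrableOn_iff_integrable_of_support_subset ?_).1 h2 |>.integrableOn
  intro x hx
  refine subset_tsupport g fun h0 => hx ?_
  simp [h0]

theorem hat_eq_schwartz (φ : 𝓓(Ω, ℂ)) : ∃ h : SchwartzMap (RSp n) ℂ, hat φ = h := by
  let e : RSp n ≃L[ℝ] RSp n :=
    ContinuousLinearEquiv.smulLeft (Units.mk0 ((2 * Real.pi)⁻¹ : ℝ) (by positivity))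
  let f : SchwartzMap (RSp n) ℂ := φ.hasCompactSupport.toSchwartzMap φ.contDiff
  refine ⟨SchwartzMap.compCLMOfContinuousLinearEquiv ℂ e (FourierTransform.fourier f), ?_⟩
  funext ξ
  have he : e ξ = (2 * Real.pi)⁻¹ • ξ := rfl
  rw [SchwartzMap.compCLMOfContinuousLinearEquiv_apply, Function.comp_apply, he,
    SchwartzMap.fourier_coe, Real.fourier_eq']
  refine integral_congr_ae (ae_of_all _ fun y => ?_)
  have hp : (-2 * Real.pi * ⟪y, (2 * Real.pi)⁻¹ • ξ⟫_ℝ : ℝ) = - ⟪y, ξ⟫_ℝ := by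
    rw [inner_smul_right]
    field_simp
  simp only [hp, smul_eq_mul]
  congr 2
  push_cast
  ring

theorem integrable_pow_mul_hat (φ : 𝓓(Ω, ℂ)) (k : ℕ) :
    Integrable (fun ξ : RSp n => (1 + ‖ξ‖) ^ k * ‖hat φ ξ‖) := by
  obtain ⟨h, hh⟩ := hat_eq_schwartz φ
  rw [hh]
  have h0 := (h.integrable_pow_mul volume 0).const_mul ((2 : ℝ) ^ (k - 1))
  have hk := (h.integrable_pow_mul volume k).const_mul ((2 : ℝ) ^ (k - 1))
  refine (h0.add hk).mono' ?_ (ae_of_all _ fun ξ => ?_)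
  · exact Continuous.aestronglyMeasurable (by fun_prop)
  · rw [Real.norm_of_nonneg (by positivity)]
    have := add_pow_le (zero_le_one' ℝ) (norm_nonneg ξ) k
    have := mul_le_mul_of_nonneg_right this (norm_nonneg (h ξ))
    simp only [Pi.add_apply, pow_zero]
    simp only [one_pow] at this
    linarith

variable {Λ : Fin n → RSp n → ℝ} {m : RSp n → ℝ} {a : RSp n × RSp n → ℂ}

theorem IsSymbol.exists_pow_bound (hm : IsAdmissibleWeight Λ m) (ha : IsSymbol Ω m Λ a)
    {K : Set (RSp n)} (hc : IsCompact K) (hK : K ⊆ Ω) :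
    ∃ (D : ℝ) (k : ℕ), ∀ x ∈ K, ∀ ξ, ‖a (x, ξ)‖ ≤ D * (1 + ‖ξ‖) ^ k := by
  obtain ⟨C, hC, h⟩ := ha.bound K hc hK 0 0
  obtain ⟨N, hN, C', hC', c, hc, htemp, -⟩ := hm.bounds
  obtain ⟨k, hk⟩ := exists_nat_ge N
  refine ⟨C * (C' * m 0), k, fun x hx ξ => ?_⟩
  have h0 : multiXi 0 (multiX 0 a) = a := by
    have : ∀ (l : List (Fin n)) (P : Fin n → (RSp n × RSp n → ℂ) → RSp n × RSp n → ℂ)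
        (b : RSp n × RSp n → ℂ),
        l.foldr (fun j g => (P j)^[(0 : Fin n → ℕ) j] g) b = b := by
      intro l P b
      induction l with
      | nil => rfl
      | cons j l _ => simp
    rw [multiXi, this, multiX, this]
  have h1 := h x hx ξ
  rw [h0] at h1
  simp only [Pi.zero_apply, pow_zero, Finset.prod_const_one, inv_one, mul_one] at h1
  have h2 := htemp 0 ξ
  rw [sub_zero] at h2
  have h3 : (1 + ‖ξ‖) ^ N ≤ (1 + ‖ξ‖) ^ k := by
    rw [← Real.rpow_natCast]
    exact Real.rpow_le_rpow_of_exponent_le (by linarith [norm_nonneg ξ]) hk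
  have hm0 := hm.pos 0
  calc ‖a (x, ξ)‖ ≤ C * m ξ := h1
    _ ≤ C * (C' * m 0 * (1 + ‖ξ‖) ^ N) := by gcongr
    _ ≤ C * (C' * m 0 * (1 + ‖ξ‖) ^ k) := by gcongr
    _ = _ := by ring

theorem norm_exp_I_mul (t : ℝ) : ‖Complex.exp (Complex.I * t)‖ = 1 := by
  rw [mul_comm, Complex.norm_exp_ofReal_mul_I]

theorem continuous_expI (x : RSp n) :
    Continuous fun ξ : RSp n => Complex.exp (Complex.I * (⟪x, ξ⟫_ℝ : ℝ)) :=
  Complex.continuous_exp.comp (continuous_const.mul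
    (Complex.continuous_ofReal.comp (continuous_const.inner continuous_id)))

theorem IsSymbol.continuous_section (ha : IsSymbol Ω m Λ a) {x : RSp n} (hx : x ∈ Ω) :
    Continuous fun ξ => a (x, ξ) := by
  rw [← continuousOn_univ]
  exact ha.smooth.continuousOn.comp (by fun_prop) fun ξ _ => ⟨hx, mem_univ _⟩

theorem continuous_hat (φ : 𝓓(Ω, ℂ)) : Continuous (hat φ) := by
  obtain ⟨h, hh⟩ := hat_eq_schwartz φ
  rw [hh]
  exact h.continuous

theorem aestronglyMeasurable_pdo_integrand (ha : IsSymbol Ω m Λ a) (φ : 𝓓(Ω, ℂ)) {x : RSp n}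
    (hx : x ∈ Ω) : AEStronglyMeasurable
      (fun ξ => Complex.exp (Complex.I * (⟪x, ξ⟫_ℝ : ℝ)) * a (x, ξ) * hat φ ξ) := by
  have h1 := ha.continuous_section hx
  have h2 := continuous_hat φ
  have h3 := continuous_expI x
  exact ((h3.mul h1).mul h2).aestronglyMeasurable

theorem integrable_pdo_integrand (hm : IsAdmissibleWeight Λ m) (ha : IsSymbol Ω m Λ a)
    (φ : 𝓓(Ω, ℂ)) {x : RSp n} (hx : x ∈ Ω) :
    Integrable (fun ξ => Complex.exp (Complex.I * (⟪x, ξ⟫_ℝ : ℝ)) * a (x, ξ) * hat φ ξ) := by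
  obtain ⟨D, k, h⟩ := ha.exists_pow_bound hm isCompact_singleton (singleton_subset_iff.2 hx)
  refine ((integrable_pow_mul_hat φ k).const_mul D).mono'
    (aestronglyMeasurable_pdo_integrand ha φ hx) (ae_of_all _ fun ξ => ?_)
  rw [norm_mul, norm_mul, norm_exp_I_mul, one_mul, ← mul_assoc]
  exact mul_le_mul_of_nonneg_right (h x rfl ξ) (norm_nonneg _)

theorem continuousOn_pdo (hm : IsAdmissibleWeight Λ m) (ha : IsSymbol Ω m Λ a)
    (φ : 𝓓(Ω, ℂ)) : ContinuousOn (pdo a φ) Ω := by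
  intro x₀ hx₀
  refine ContinuousAt.continuousWithinAt ?_
  refine continuousAt_const.mul ?_
  obtain ⟨K, hKx, hKΩ, hK⟩ := local_compact_nhds (Ω.isOpen.mem_nhds hx₀)
  obtain ⟨D, k, h⟩ := ha.exists_pow_bound hm hK hKΩ
  refine continuousAt_of_dominated (bound := fun ξ => D * ((1 + ‖ξ‖) ^ k * ‖hat φ ξ‖))
    ?_ ?_ ((integrable_pow_mul_hat φ k).const_mul D) ?_
  · filter_upwards [hKx] with x hx
    exact aestronglyMeasurable_pdo_integrand ha φ (hKΩ hx)
  · filter_upwards [hKx] with x hx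
    refine ae_of_all _ fun ξ => ?_
    rw [norm_mul, norm_mul, norm_exp_I_mul, one_mul, ← mul_assoc]
    exact mul_le_mul_of_nonneg_right (h x hx ξ) (norm_nonneg _)
  · refine ae_of_all _ fun ξ => ?_
    have h1 : ContinuousAt (fun x => a (x, ξ)) x₀ := by
      have := ha.smooth.continuousOn.continuousAt
        ((Ω.isOpen.prod isOpen_univ).mem_nhds (mk_mem_prod hx₀ (mem_univ ξ)))
      exact ContinuousAt.comp (f := fun x => (x, ξ)) this (by fun_prop)
    have h2 : ContinuousAt (fun x : RSp n => Complex.exp (Complex.I * (⟪x, ξ⟫_ℝ : ℝ))) x₀ :=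
      (Complex.continuous_exp.comp (continuous_const.mul (Complex.continuous_ofReal.comp
        (continuous_id.inner continuous_const)))).continuousAt
    exact (h2.mul h1).mul continuousAt_const

theorem integrable_hat_integrand (φ : 𝓓(Ω, ℂ)) (ξ : RSp n) :
    Integrable fun y => Complex.exp (-(Complex.I * (⟪y, ξ⟫_ℝ : ℝ))) * φ y := by
  have h : Continuous fun y : RSp n => Complex.exp (-(Complex.I * (⟪y, ξ⟫_ℝ : ℝ))) :=
    Complex.continuous_exp.comp (continuous_const.mul (Complex.continuous_ofReal.comp
        (continuous_id.inner continuous_const))).neg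
  exact (h.mul φ.continuous).integrable_of_hasCompactSupport φ.hasCompactSupport.mul_left

theorem hat_add (φ ψ : 𝓓(Ω, ℂ)) (ξ : RSp n) : hat ⇑(φ + ψ) ξ = hat φ ξ + hat ψ ξ := by
  unfold hat
  rw [← integral_add (integrable_hat_integrand φ ξ) (integrable_hat_integrand ψ ξ)]
  refine integral_congr_ae (ae_of_all _ fun y => ?_)
  change _ * (φ y + ψ y) = _
  ring

theorem hat_smul (c : ℂ) (φ : 𝓓(Ω, ℂ)) (ξ : RSp n) : hat ⇑(c • φ) ξ = c * hat φ ξ := by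
  unfold hat
  rw [← integral_const_mul]
  refine integral_congr_ae (ae_of_all _ fun y => ?_)
  change _ * (c * φ y) = _
  ring

theorem pdo_add (hm : IsAdmissibleWeight Λ m) (ha : IsSymbol Ω m Λ a) (φ ψ : 𝓓(Ω, ℂ))
    {x : RSp n} (hx : x ∈ Ω) : pdo a ⇑(φ + ψ) x = pdo a φ x + pdo a ψ x := by
  unfold pdo
  rw [← mul_add, ← integral_add (integrable_pdo_integrand hm ha φ hx)
    (integrable_pdo_integrand hm ha ψ hx)]
  congr 1
  refine integral_congr_ae (ae_of_all _ fun ξ => ?_)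
  simp only [hat_add]
  ring

theorem pdo_smul (a : RSp n × RSp n → ℂ) (c : ℂ) (φ : 𝓓(Ω, ℂ)) (x : RSp n) :
    pdo a ⇑(c • φ) x = c * pdo a φ x := by
  unfold pdo
  rw [mul_left_comm, ← integral_const_mul c]
  congr 1
  refine integral_congr_ae (ae_of_all _ fun ξ => ?_)
  simp only [hat_smul c φ]
  ring

end aux

/-! ### The operators `T_a`, `T_{a,0}`, `T_{a,1}` and dual operators -/

section operators

variable {Ω : Opens (RSp n)} {Λ : Fin n → RSp n → ℝ} {m : RSp n → ℝ}
  {a : RSp n × RSp n → ℂ}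

/-- The embedding `C₀^∞(Ω) → L^p_loc(Ω)`. -/
def incl (Ω : Opens (RSp n)) (p : ℝ≥0∞) : 𝓓(Ω, ℂ) →ₗ[ℂ] LpLoc Ω p where
  toFun φ := LpLoc.ofContinuousOn p φ φ.continuous.continuousOn
  map_add' φ ψ := LpLoc.ext <| by
    filter_upwards [LpLoc.coeFn_ofContinuousOn (p := p) ⇑(φ + ψ) (φ + ψ).continuous.continuousOn,
      LpLoc.coeFn_ofContinuousOn (p := p) φ (Ω := Ω) φ.continuous.continuousOn,
      LpLoc.coeFn_ofContinuousOn (p := p) ψ (Ω := Ω) ψ.continuous.continuousOn,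
      LpLoc.coeFn_add (LpLoc.ofContinuousOn (Ω := Ω) p φ φ.continuous.continuousOn)
        (LpLoc.ofContinuousOn p ψ ψ.continuous.continuousOn)] with x h1 h2 h3 h4
    rw [h1, h4, h2, h3]
    rfl
  map_smul' c φ := LpLoc.ext <| by
    filter_upwards [LpLoc.coeFn_ofContinuousOn (p := p) ⇑(c • φ) (c • φ).continuous.continuousOn,
      LpLoc.coeFn_ofContinuousOn (p := p) φ (Ω := Ω) φ.continuous.continuousOn,
      LpLoc.coeFn_smul c (LpLoc.ofContinuousOn (Ω := Ω) p φ φ.continuous.continuousOn)]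
      with x h1 h2 h3
    simp only [RingHom.id_apply]
    rw [h1, h3, h2]
    rfl

theorem incl_injective (Ω : Opens (RSp n)) (p : ℝ≥0∞) : Function.Injective (incl Ω p) := by
  intro φ ψ h
  have h1 := LpLoc.coeFn_ofContinuousOn (p := p) φ (Ω := Ω) φ.continuous.continuousOn
  have h2 := LpLoc.coeFn_ofContinuousOn (p := p) ψ (Ω := Ω) ψ.continuous.continuousOn
  have h3 : (φ : RSp n → ℂ) =ᵐ[volume.restrict (Ω : Set (RSp n))] ψ := by
    change LpLoc.ofContinuousOn p φ φ.continuous.continuousOn =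
      LpLoc.ofContinuousOn p ψ ψ.continuous.continuousOn at h
    rw [h] at h1
    exact h1.symm.trans h2
  have h4 := Measure.eqOn_open_of_ae_eq h3 Ω.isOpen φ.continuous.continuousOn
    ψ.continuous.continuousOn
  ext x
  by_cases hx : x ∈ Ω
  · exact h4 hx
  · rw [image_eq_zero_of_notMem_tsupport fun h => hx (φ.tsupport_subset h),
      image_eq_zero_of_notMem_tsupport fun h => hx (ψ.tsupport_subset h)]

/-- `φ ↦ a(x, D)φ` as a linear map from `C₀^∞(Ω)` to `L^p_loc(Ω)`. -/
def pdoLp (hm : IsAdmissibleWeight Λ m) (ha : IsSymbol Ω m Λ a) (p : ℝ≥0∞) :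
    𝓓(Ω, ℂ) →ₗ[ℂ] LpLoc Ω p where
  toFun φ := LpLoc.ofContinuousOn p (pdo a φ) (continuousOn_pdo hm ha φ)
  map_add' φ ψ := LpLoc.ext <| by
    filter_upwards [LpLoc.coeFn_ofContinuousOn (p := p) _ (continuousOn_pdo hm ha (φ + ψ)),
      LpLoc.coeFn_ofContinuousOn (p := p) _ (continuousOn_pdo hm ha φ),
      LpLoc.coeFn_ofContinuousOn (p := p) _ (continuousOn_pdo hm ha ψ),
      LpLoc.coeFn_add (LpLoc.ofContinuousOn p _ (continuousOn_pdo hm ha φ))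
        (LpLoc.ofContinuousOn p _ (continuousOn_pdo hm ha ψ)),
      ae_restrict_mem Ω.isOpen.measurableSet] with x h1 h2 h3 h4 hx
    rw [h1, h4, h2, h3, pdo_add hm ha φ ψ hx]
  map_smul' c φ := LpLoc.ext <| by
    filter_upwards [LpLoc.coeFn_ofContinuousOn (p := p) _ (continuousOn_pdo hm ha (c • φ)),
      LpLoc.coeFn_ofContinuousOn (p := p) _ (continuousOn_pdo hm ha φ),
      LpLoc.coeFn_smul c (LpLoc.ofContinuousOn p _ (continuousOn_pdo hm ha φ))] with x h1 h2 h3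
    simp only [RingHom.id_apply]
    rw [h1, h3, h2, pdo_smul a]

/-- `T_a`: the operator `a(x, D)` in `L^p_loc(Ω)` with domain `C₀^∞(Ω)`. -/
def opT (hm : IsAdmissibleWeight Λ m) (ha : IsSymbol Ω m Λ a) (p : ℝ≥0∞) :
    LpLoc Ω p →ₗ.[ℂ] LpLoc Ω p where
  domain := LinearMap.range (incl Ω p)
  toFun := pdoLp hm ha p ∘ₗ
    ((LinearEquiv.ofInjective (incl Ω p) (incl_injective Ω p)).symm : _ →ₗ[ℂ] 𝓓(Ω, ℂ))

theorem opT_incl (hm : IsAdmissibleWeight Λ m) (ha : IsSymbol Ω m Λ a) (p : ℝ≥0∞)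
    (φ : 𝓓(Ω, ℂ)) :
    opT hm ha p ⟨incl Ω p φ, LinearMap.mem_range_self _ φ⟩ = pdoLp hm ha p φ := by
  change pdoLp hm ha p ((LinearEquiv.ofInjective (incl Ω p) (incl_injective Ω p)).symm _) = _
  congr 1
  exact (LinearEquiv.ofInjective (incl Ω p) (incl_injective Ω p)).symm_apply_apply φ

variable {p : ℝ≥0∞}

/-- The minimal extension `T_{a,0}`: the smallest closed extension of `T_a`, that is, the operator
whose graph is the closure of the graph of `T_a`. -/
def minimalExtension (hm : IsAdmissibleWeight Λ m) (ha : IsSymbol Ω m Λ a) (p : ℝ≥0∞)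
    [Fact (1 ≤ p)] : LpLoc Ω p →ₗ.[ℂ] LpLoc Ω p := (opT hm ha p).closure

theorem integrable_sesq [Fact (1 ≤ p)] (u : LpLoc Ω p) (g : 𝓓(Ω, ℂ)) :
    Integrable (fun x => u x * conj (g x)) (volume.restrict (Ω : Set (RSp n))) := by
  have hs : Function.support (fun x => conj (g x)) = Function.support g := by
    ext x; simp
  have ht : tsupport (fun x => conj (g x)) = tsupport g := by
    rw [tsupport, tsupport, hs]
  refine u.integrable_mul_testFunction (Complex.continuous_conj.comp g.continuous) ?_ ?_
  · rw [HasCompactSupport, ht]; exact g.hasCompactSupport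
  · rw [ht]; exact g.tsupport_subset

theorem sesq_add [Fact (1 ≤ p)] (u v : LpLoc Ω p) (g : 𝓓(Ω, ℂ)) :
    sesq Ω ⇑(u + v) g = sesq Ω u g + sesq Ω v g := by
  unfold sesq
  rw [← integral_add (integrable_sesq u g) (integrable_sesq v g)]
  refine integral_congr_ae ?_
  filter_upwards [LpLoc.coeFn_add u v] with x hx
  rw [hx]; ring

theorem sesq_smul (c : ℂ) (u : LpLoc Ω p) (g : 𝓓(Ω, ℂ)) :
    sesq Ω ⇑(c • u) g = c * sesq Ω u g := by
  unfold sesq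
  rw [← integral_const_mul]
  refine integral_congr_ae ?_
  filter_upwards [LpLoc.coeFn_smul c u] with x hx
  rw [hx]; ring

theorem sesq_zero (g : 𝓓(Ω, ℂ)) : sesq Ω ⇑(0 : LpLoc Ω p) g = 0 := by
  unfold sesq
  rw [integral_congr_ae (g := fun _ => (0 : ℂ)), integral_zero]
  filter_upwards [LpLoc.coeFn_zero (Ω := Ω) (p := p)] with x hx
  rw [hx]; ring

/-- The graph of the maximal extension: the pairs `(u, f)` in `L^p_loc(Ω)` with
`(u, a(x, D)* φ) = (f, φ)` for all `φ ∈ C₀^∞(Ω)`. -/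
def maximalGraph (Ω : Opens (RSp n)) (a : RSp n × RSp n → ℂ) (p : ℝ≥0∞) [Fact (1 ≤ p)] :
    Submodule ℂ (LpLoc Ω p × LpLoc Ω p) where
  carrier := {w | ∀ φ : 𝓓(Ω, ℂ), sesq Ω w.1 (formalAdjoint Ω a φ) = sesq Ω w.2 φ}
  zero_mem' := fun φ => by
    change sesq Ω ⇑(0 : LpLoc Ω p) _ = sesq Ω ⇑(0 : LpLoc Ω p) _
    rw [sesq_zero, sesq_zero]
  add_mem' := fun {v w} hv hw φ => by
    change sesq Ω ⇑(v.1 + w.1) _ = sesq Ω ⇑(v.2 + w.2) _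
    rw [sesq_add, sesq_add, hv φ, hw φ]
  smul_mem' := fun c w hw φ => by
    change sesq Ω ⇑(c • w.1) _ = sesq Ω ⇑(c • w.2) _
    rw [sesq_smul, sesq_smul, hw φ]

/-- The maximal extension `T_{a,1}`. Its domain consists of the `u ∈ L^p_loc(Ω)` for which there is
`f ∈ L^p_loc(Ω)` with `(u, a(x, D)* φ) = (f, φ)` for all `φ ∈ C₀^∞(Ω)`; then `T_{a,1} u = f`. -/
def maximalExtension (Ω : Opens (RSp n)) (a : RSp n × RSp n → ℂ) (p : ℝ≥0∞) [Fact (1 ≤ p)] :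
    LpLoc Ω p →ₗ.[ℂ] LpLoc Ω p := (maximalGraph Ω a p).toLinearPMap

/-- The function `f` in the definition of `T_{a,1} u` is unique, so that `maximalGraph` is
indeed the graph of `T_{a,1}`. -/
theorem graph_maximalExtension (Ω : Opens (RSp n)) (a : RSp n × RSp n → ℂ) (p : ℝ≥0∞)
    [Fact (1 ≤ p)] : (maximalExtension Ω a p).graph = maximalGraph Ω a p := by
  refine Submodule.toLinearPMap_graph_eq _ ?_
  rintro ⟨u, f⟩ h (rfl : u = 0)
  change f = 0
  have hf : ∀ φ : 𝓓(Ω, ℂ), sesq Ω f φ = 0 := fun φ => by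
    rw [← h φ, sesq_zero]
  have hl : LocallyIntegrableOn f (Ω : Set (RSp n)) volume := by
    rw [locallyIntegrableOn_iff Ω.isOpen.isLocallyClosed]
    intro K hK hc
    have : IsFiniteMeasure ((volume : Measure (RSp n)).restrict K) :=
      ⟨by simpa using hc.measure_lt_top⟩
    exact memLp_one_iff_integrable.1 ((f.memLp hc hK).mono_exponent Fact.out)
  refine LpLoc.ext (EventuallyEq.trans ?_ LpLoc.coeFn_zero.symm)
  refine (ae_restrict_iff' Ω.isOpen.measurableSet).2 ?_
  refine Ω.isOpen.ae_eq_zero_of_integral_contDiff_smul_eq_zero hl fun g hg hgc hgs => ?_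
  have hs : Function.support (fun x => (g x : ℂ)) = Function.support g := by
    ext x; simp
  have ht : tsupport (fun x => (g x : ℂ)) = tsupport g := by
    rw [tsupport, tsupport, hs]
  let φ : 𝓓(Ω, ℂ) := ⟨fun x => (g x : ℂ), Complex.ofRealCLM.contDiff.comp hg,
    by rw [HasCompactSupport, ht]; exact hgc, by rw [ht]; exact hgs⟩
  rw [← hf φ, sesq, ← setIntegral_eq_integral_of_forall_compl_eq_zero (s := (Ω : Set (RSp n)))]
  · refine integral_congr_ae (ae_of_all _ fun x => ?_)
    change g x • f x = f x * conj ((g x : ℝ) : ℂ)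
    rw [Complex.conj_ofReal, Complex.real_smul, mul_comm]
  · intro x hx
    rw [image_eq_zero_of_notMem_tsupport fun h => hx (hgs h), zero_smul]

/-- The linear functional `u ↦ ⟨u, φ⟩ = ∫_Ω u φ` on `L^p_loc(Ω)`. -/
def testLinear (p : ℝ≥0∞) [Fact (1 ≤ p)] (φ : 𝓓(Ω, ℂ)) : LpLoc Ω p →ₗ[ℂ] ℂ where
  toFun u := ∫ x in (Ω : Set (RSp n)), u x * φ x
  map_add' u v := by
    rw [← integral_add (u.integrable_mul_testFunction φ.continuous φ.hasCompactSupport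
      φ.tsupport_subset) (v.integrable_mul_testFunction φ.continuous φ.hasCompactSupport
      φ.tsupport_subset)]
    refine integral_congr_ae ?_
    filter_upwards [LpLoc.coeFn_add u v] with x hx
    rw [hx]; ring
  map_smul' c u := by
    rw [RingHom.id_apply, smul_eq_mul, ← integral_const_mul]
    refine integral_congr_ae ?_
    filter_upwards [LpLoc.coeFn_smul c u] with x hx
    rw [hx]; ring

theorem continuous_testLinear (p : ℝ≥0∞) [Fact (1 ≤ p)] (φ : 𝓓(Ω, ℂ)) :
    Continuous (testLinear p φ) := by
  let S : Set (RSp n) := tsupport φ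
  let K : {K : Compacts (RSp n) // (K : Set (RSp n)) ⊆ Ω} :=
    ⟨⟨S, φ.hasCompactSupport⟩, φ.tsupport_subset⟩
  have hS : IsCompact S := φ.hasCompactSupport
  have hSΩ : S ⊆ Ω := φ.tsupport_subset
  obtain ⟨B, hB⟩ := φ.continuous.bounded_above_of_compact_support φ.hasCompactSupport
  have hB0 : 0 ≤ B := (norm_nonneg _).trans (hB 0)
  have hfin : IsFiniteMeasure ((volume : Measure (RSp n)).restrict S) :=
    ⟨by simpa using hS.measure_lt_top⟩
  let M : ℝ≥0∞ := (volume : Measure (RSp n)).restrict S univ ^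
    (1 / (1 : ℝ≥0∞).toReal - 1 / p.toReal)
  have hM : M ≠ ⊤ := by
    refine ENNReal.rpow_ne_top_of_nonneg ?_ (measure_ne_top _ _)
    rw [ENNReal.toReal_one, div_one, sub_nonneg]
    rcases eq_or_ne p ⊤ with rfl | hp
    · simp
    · have h1 : (1 : ℝ) ≤ p.toReal := by
        have := (ENNReal.toReal_le_toReal ENNReal.one_ne_top hp).2 (Fact.out : 1 ≤ p)
        simpa using this
      rw [div_le_one (by linarith)]
      exact h1
  refine LpLoc.withSeminorms.continuous_of_isBounded (norm_withSeminorms ℂ ℂ) _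
    (Seminorm.IsBounded.of_real fun _ => ⟨{K}, B * M.toReal, fun u => ?_⟩)
  rw [Finset.sup_singleton]
  change ‖∫ x in (Ω : Set (RSp n)), u x * φ x‖ ≤
    B * M.toReal * (eLpNorm u p (volume.restrict S)).toReal
  have hu := u.memLp hS hSΩ
  have h1 : Integrable u (volume.restrict S) :=
    memLp_one_iff_integrable.1 (hu.mono_exponent Fact.out)
  have h0 : ∀ x ∉ S, u x * φ x = 0 := fun x hx => by
    rw [image_eq_zero_of_notMem_tsupport hx, mul_zero]
  have h2 : ∫ x in (Ω : Set (RSp n)), u x * φ x = ∫ x in S, u x * φ x := by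
    rw [setIntegral_eq_integral_of_forall_compl_eq_zero fun x hx => h0 x fun h => hx (hSΩ h),
      setIntegral_eq_integral_of_forall_compl_eq_zero h0]
  have h3 : ∫ x in S, ‖u x‖ = (eLpNorm u 1 (volume.restrict S)).toReal := by
    rw [integral_norm_eq_lintegral_enorm h1.1, eLpNorm_one_eq_lintegral_enorm]
  have h4 : (eLpNorm u 1 (volume.restrict S)).toReal ≤
      (eLpNorm u p (volume.restrict S)).toReal * M.toReal := by
    rw [← ENNReal.toReal_mul]
    exact ENNReal.toReal_mono (ENNReal.mul_ne_top hu.2.ne hM)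
      (eLpNorm_le_eLpNorm_mul_rpow_measure_univ Fact.out hu.1)
  calc ‖∫ x in (Ω : Set (RSp n)), u x * φ x‖ = ‖∫ x in S, u x * φ x‖ := by rw [h2]
    _ ≤ ∫ x in S, B * ‖u x‖ := by
        refine norm_integral_le_of_norm_le (h1.norm.const_mul B) (ae_of_all _ fun x => ?_)
        rw [norm_mul, mul_comm]
        exact mul_le_mul_of_nonneg_right (hB x) (norm_nonneg _)
    _ = B * (eLpNorm u 1 (volume.restrict S)).toReal := by rw [integral_const_mul, h3]
    _ ≤ B * ((eLpNorm u p (volume.restrict S)).toReal * M.toReal) := by gcongr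
    _ = _ := by ring

/-- The element `u ↦ ⟨u, φ⟩ = ∫_Ω u φ` of the dual of `L^p_loc(Ω)` with which `φ ∈ C₀^∞(Ω)` is
identified. -/
def testFunctional (p : ℝ≥0∞) [Fact (1 ≤ p)] (φ : 𝓓(Ω, ℂ)) : StrongDual ℂ (LpLoc Ω p) :=
  ⟨testLinear p φ, continuous_testLinear p φ⟩

/-- The dual operator `T' : Y' → X'` of a densely defined operator `T : X → Y`: its domain consists
of the `y'` for which there is `x'` with `⟨T x, y'⟩ = ⟨x, x'⟩` for all `x ∈ D(T)`; then
`T' y' = x'`. -/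
def dualOperator {X Y : Type*} [AddCommGroup X] [Module ℂ X] [TopologicalSpace X]
    [IsTopologicalAddGroup X] [ContinuousSMul ℂ X] [AddCommGroup Y] [Module ℂ Y]
    [TopologicalSpace Y] [IsTopologicalAddGroup Y] [ContinuousSMul ℂ Y] (T : X →ₗ.[ℂ] Y) :
    StrongDual ℂ Y →ₗ.[ℂ] StrongDual ℂ X :=
  Submodule.toLinearPMap
    { carrier := {w | ∀ x : T.domain, w.1 (T x) = w.2 x}
      zero_mem' := fun _ => rfl
      add_mem' := fun {v w} hv hw x => by
        change v.1 (T x) + w.1 (T x) = v.2 x + w.2 x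
        rw [hv x, hw x]
      smul_mem' := fun c w hw x => by
        change c • w.1 (T x) = c • w.2 x
        rw [hw x] }

theorem mem_domain_dualOperator {X Y : Type*} [AddCommGroup X] [Module ℂ X] [TopologicalSpace X]
    [IsTopologicalAddGroup X] [ContinuousSMul ℂ X] [AddCommGroup Y] [Module ℂ Y]
    [TopologicalSpace Y] [IsTopologicalAddGroup Y] [ContinuousSMul ℂ Y] (T : X →ₗ.[ℂ] Y)
    (y' : StrongDual ℂ Y) :
    y' ∈ (dualOperator T).domain ↔ ∃ x' : StrongDual ℂ X, ∀ x : T.domain, y' (T x) = x' x := by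
  rw [dualOperator, Submodule.toLinearPMap_domain]
  simp

/-- `C₀^∞(Ω)` is contained in the domain of the dual operator of `B`. -/
def TestFunctionsInDualDomain {p : ℝ≥0∞} [Fact (1 ≤ p)] (B : LpLoc Ω p →ₗ.[ℂ] LpLoc Ω p) : Prop :=
  ∀ φ : 𝓓(Ω, ℂ), testFunctional p φ ∈ (dualOperator B).domain

end operators

end MPseudo

end

open MPseudo

/-! The analytic core is that the formal adjoint of a(x, D) exists on test functions, so that
`formalAdjoint` really satisfies (T_a φ, ψ) = (φ, T_a* ψ) (`sesq_pdo_eq`). Put I(ξ) = ∫ e^{i x·ξ}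
a(x, ξ) ψ(x) dx. Repeated integration by parts in x, together with the polynomial growth of m, makes
I decay faster than any power (`symbolIntegral_decay`). Of the symbol estimates, only those without
ξ-derivatives are needed for this. The Fourier transform of I is therefore smooth, and Fubini
identifies it, up to a constant, with the transpose of a(x, D) applied to ψ (`integral_pdo_mul`).
Proper support then permits cutting it off to a test function without changing its pairings
(`exists_formalAdjoint`).

The rest is duality. The graph of T_{a,1} is cut out by equalities of continuous functionals, so it
is closed, and these equalities also exhibit the dual of T_{a,1} on test functions. The adjoint
identity puts T_a, and hence its closure, below T_{a,1}. If B extends T_a and its dual B' is defined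
at the conjugate of ψ, then the value of B' there is known on test functions, where B = T_a. Test
functions are dense for p < ∞ (`denseRange_incl`), so this value is the conjugate of T_a* ψ. Pairing
it with an arbitrary v in D(B) gives exactly the condition that defines T_{a,1} v = B v. -/

noncomputable section

namespace MPseudo

/-! ### Cutoffs and conjugates of test functions -/

section symbols

variable {n : ℕ} {Ω : Opens (RSp n)} {Λ : Fin n → RSp n → ℝ} {m : RSp n → ℝ}
  {a : RSp n × RSp n → ℂ}

/-- A smooth compactly supported cutoff that equals `1` on a compact subset of `Ω`. -/
theorem exists_cutoff {K : Set (RSp n)} (hK : IsCompact K) (hKΩ : K ⊆ Ω) :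
    ∃ χ : 𝓓(Ω, ℂ), ∀ x ∈ K, χ x = 1 := by
  obtain ⟨L, hL, hKL, hLΩ⟩ := exists_compact_between hK Ω.isOpen hKΩ
  obtain ⟨f, hf1, hf0, -⟩ := exists_contMDiffMap_one_nhds_of_subset_interior
    (modelWithCornersSelf ℝ (RSp n)) (n := ⊤) hK.isClosed hKL
  have hsub : tsupport (fun x => (f x : ℂ)) ⊆ L := by
    refine closure_minimal (fun x hx => ?_) hL.isClosed
    by_contra h
    exact hx (by simp [hf0 x h])
  refine ⟨⟨fun x => (f x : ℂ), Complex.ofRealCLM.contDiff.comp f.contMDiff.contDiff,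
    hL.of_isClosed_subset (isClosed_tsupport _) hsub, hsub.trans hLΩ⟩, fun x hx => ?_⟩
  change ((f x : ℝ) : ℂ) = 1
  rw [(hf1.self_of_nhdsSet x hx), Complex.ofReal_one]

/-- Complex conjugation of test functions. -/
def conjTest (φ : 𝓓(Ω, ℂ)) : 𝓓(Ω, ℂ) where
  toFun x := conj (φ x)
  contDiff' := Complex.conjCLE.contDiff.comp φ.contDiff
  hasCompactSupport' := φ.hasCompactSupport.comp_left (map_zero _)
  tsupport_subset' := (closure_mono (Function.support_comp_subset (map_zero _) _)).trans
    φ.tsupport_subset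

@[simp]
theorem conjTest_apply (φ : 𝓓(Ω, ℂ)) (x : RSp n) : conjTest φ x = conj (φ x) := rfl

@[simp]
theorem conjTest_conjTest (φ : 𝓓(Ω, ℂ)) : conjTest (conjTest φ) = φ := by
  ext x; simp

/-- Multiplication of a smooth function by a test function. -/
def cutoffMul (χ : 𝓓(Ω, ℂ)) (f : RSp n → ℂ) (hf : ContDiff ℝ ∞ f) : 𝓓(Ω, ℂ) where
  toFun x := χ x * f x
  contDiff' := χ.contDiff.mul hf
  hasCompactSupport' := χ.hasCompactSupport.mul_right
  tsupport_subset' := (tsupport_mul_subset_left).trans χ.tsupport_subset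

@[simp]
theorem cutoffMul_apply (χ : 𝓓(Ω, ℂ)) (f : RSp n → ℂ) (hf : ContDiff ℝ ∞ f) (x : RSp n) :
    cutoffMul χ f hf x = χ x * f x := rfl

/-! ### Symbols multiplied by test functions -/

/-- Nothing is known about b outside Ω × ℝⁿ, but there ψ vanishes in a neighbourhood of the base
point, so the product is locally zero. -/
theorem contDiff_symbol_mul {b : RSp n × RSp n → ℂ}
    (hb : ContDiffOn ℝ ∞ b ((Ω : Set (RSp n)) ×ˢ univ)) {ψ : RSp n → ℂ} (hψ : ContDiff ℝ ∞ ψ)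
    (hs : tsupport ψ ⊆ Ω) : ContDiff ℝ ∞ fun z : RSp n × RSp n => b z * ψ z.1 := by
  rw [contDiff_iff_contDiffAt]
  intro z
  by_cases hz : z.1 ∈ Ω
  · exact (hb.contDiffAt ((Ω.isOpen.prod isOpen_univ).mem_nhds ⟨hz, mem_univ _⟩)).mul
      (hψ.comp contDiff_fst).contDiffAt
  · have h0 : ψ =ᶠ[𝓝 z.1] 0 := notMem_tsupport_iff_eventuallyEq.1 fun h => hz (hs h)
    have h1 : (fun z : RSp n × RSp n => b z * ψ z.1) =ᶠ[𝓝 z] fun _ => 0 := by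
      filter_upwards [continuousAt_fst.eventually h0] with w hw
      simp [hw]
    exact contDiffAt_const.congr_of_eventuallyEq h1

theorem contDiff_symbol_mul_section {b : RSp n × RSp n → ℂ}
    (hb : ContDiffOn ℝ ∞ b ((Ω : Set (RSp n)) ×ˢ univ)) {ψ : RSp n → ℂ} (hψ : ContDiff ℝ ∞ ψ)
    (hs : tsupport ψ ⊆ Ω) (ξ : RSp n) : ContDiff ℝ ∞ fun x => b (x, ξ) * ψ x :=
  (contDiff_symbol_mul hb hψ hs).comp (contDiff_prodMk_left ξ)

theorem contDiffOn_partialX {b : RSp n × RSp n → ℂ}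
    (hb : ContDiffOn ℝ ∞ b ((Ω : Set (RSp n)) ×ˢ univ)) (j : Fin n) :
    ContDiffOn ℝ ∞ (partialX j b) ((Ω : Set (RSp n)) ×ˢ univ) :=
  (hb.fderiv_of_isOpen (Ω.isOpen.prod isOpen_univ) (m := ∞) (by simp)).clm_apply contDiffOn_const

theorem fderiv_symbol_mul_section {b : RSp n × RSp n → ℂ}
    (hb : ContDiffOn ℝ ∞ b ((Ω : Set (RSp n)) ×ˢ univ)) {ψ : RSp n → ℂ} (hψ : ContDiff ℝ ∞ ψ)
    (hs : tsupport ψ ⊆ Ω) (ξ x : RSp n) (j : Fin n) :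
    fderiv ℝ (fun x => b (x, ξ) * ψ x) x (EuclideanSpace.single j 1) =
      partialX j b (x, ξ) * ψ x + b (x, ξ) * fderiv ℝ ψ x (EuclideanSpace.single j 1) := by
  by_cases hx : x ∈ Ω
  · have hbx : HasFDerivAt b (fderiv ℝ b (x, ξ)) (x, ξ) :=
      ((hb.contDiffAt ((Ω.isOpen.prod isOpen_univ).mem_nhds ⟨hx, mem_univ _⟩)).differentiableAt
        (by simp)).hasFDerivAt
    have h1 := hbx.comp (f := fun x => (x, ξ)) x (hasFDerivAt_prodMk_left x ξ)
    have h2 := (hψ.differentiable (by simp) x).hasFDerivAt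
    have h3 := (h1.mul h2).fderiv
    change fderiv ℝ ((b ∘ fun x => (x, ξ)) * ψ) x _ = _
    rw [h3]
    simp [partialX]
    ring
  · have hx' : x ∉ tsupport ψ := fun h => hx (hs h)
    have h0 : ψ =ᶠ[𝓝 x] 0 := notMem_tsupport_iff_eventuallyEq.1 hx'
    have h1 : (fun x => b (x, ξ) * ψ x) =ᶠ[𝓝 x] fun _ => 0 := by
      filter_upwards [h0] with w hw
      simp [hw]
    rw [h1.fderiv_eq, h0.fderiv_eq, image_eq_zero_of_notMem_tsupport hx']
    simp

/-! ### Integration by parts against e^{i x·ξ} -/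

theorem integrable_expI_mul {g : RSp n → ℂ} (hg : Continuous g) (hc : HasCompactSupport g)
    (ξ : RSp n) : Integrable fun x => Complex.exp (Complex.I * (⟪x, ξ⟫_ℝ : ℝ)) * g x := by
  refine Continuous.integrable_of_hasCompactSupport ?_ hc.mul_left
  have h := continuous_expI ξ
  simp_rw [real_inner_comm] at h ⊢
  exact h.mul hg

theorem fderiv_expI (ξ x v : RSp n) :
    fderiv ℝ (fun x : RSp n => Complex.exp (Complex.I * (⟪x, ξ⟫_ℝ : ℝ))) x v =
      Complex.exp (Complex.I * (⟪x, ξ⟫_ℝ : ℝ)) * (Complex.I * (⟪v, ξ⟫_ℝ : ℝ)) := by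
  have h1 : HasFDerivAt (fun x : RSp n => ⟪x, ξ⟫_ℝ) (innerSL ℝ ξ) x := by
    simp_rw [real_inner_comm ξ]
    exact (innerSL ℝ ξ).hasFDerivAt
  have h2 := ((Complex.ofRealCLM.hasFDerivAt.comp x h1).const_mul Complex.I).cexp
  have h3 := h2.fderiv
  simp only [Function.comp_def, Complex.ofRealCLM_apply] at h3
  rw [h3]
  simp [real_inner_comm]

theorem differentiable_expI (ξ : RSp n) :
    Differentiable ℝ (fun x : RSp n => Complex.exp (Complex.I * (⟪x, ξ⟫_ℝ : ℝ))) := by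
  intro x
  exact (DifferentiableAt.const_mul (Complex.ofRealCLM.differentiableAt.comp x
    (differentiableAt_id.inner ℝ (differentiableAt_const ξ))) Complex.I).cexp

theorem mul_integral_expI_mul {g : RSp n → ℂ} (hg : ContDiff ℝ ∞ g) (hc : HasCompactSupport g)
    (ξ : RSp n) (j : Fin n) :
    Complex.I * (ξ j : ℂ) * ∫ x, Complex.exp (Complex.I * (⟪x, ξ⟫_ℝ : ℝ)) * g x =
      -∫ x, Complex.exp (Complex.I * (⟪x, ξ⟫_ℝ : ℝ)) *
        fderiv ℝ g x (EuclideanSpace.single j 1) := by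
  have hd : Continuous fun x => fderiv ℝ g x (EuclideanSpace.single j (1 : ℝ)) :=
    (hg.continuous_fderiv (by simp)).clm_apply continuous_const
  have hi : ∀ x, fderiv ℝ (fun x : RSp n => Complex.exp (Complex.I * (⟪x, ξ⟫_ℝ : ℝ))) x
      (EuclideanSpace.single j 1) * g x =
      Complex.I * (ξ j : ℂ) * (Complex.exp (Complex.I * (⟪x, ξ⟫_ℝ : ℝ)) * g x) := by
    intro x
    rw [fderiv_expI, EuclideanSpace.inner_single_left]
    simp
    ring
  have hI := integrable_expI_mul hg.continuous hc ξ
  rw [integral_mul_fderiv_eq_neg_fderiv_mul_of_integrable, neg_neg, ← integral_const_mul]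
  · exact integral_congr_ae (ae_of_all _ fun x => (hi x).symm)
  · simp_rw [hi]
    exact hI.const_mul _
  · exact integrable_expI_mul hd (hc.fderiv_apply ℝ _) ξ
  · exact hI
  · exact fun x _ => differentiable_expI ξ x
  · exact fun x _ => hg.differentiable (by simp) x

theorem norm_integral_expI_mul_symbol_le {b : RSp n × RSp n → ℂ} {ψ : RSp n → ℂ}
    (hψ : Continuous ψ) (hc : HasCompactSupport ψ) (ξ : RSp n) {C : ℝ}
    (hC : ∀ x ∈ tsupport ψ, ‖b (x, ξ)‖ ≤ C) :
    ‖∫ x, Complex.exp (Complex.I * (⟪x, ξ⟫_ℝ : ℝ)) * (b (x, ξ) * ψ x)‖ ≤ C * ∫ x, ‖ψ x‖ := by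
  rw [← integral_const_mul]
  refine norm_integral_le_of_norm_le
    ((hψ.integrable_of_hasCompactSupport hc).norm.const_mul C) (ae_of_all _ fun x => ?_)
  rw [norm_mul, norm_exp_I_mul, one_mul, norm_mul]
  by_cases hx : x ∈ tsupport ψ
  · exact mul_le_mul_of_nonneg_right (hC x hx) (norm_nonneg _)
  · simp [image_eq_zero_of_notMem_tsupport hx]

/-- Rapid decay, in each coordinate direction, of the Fourier integral in `x` of a symbol. -/
theorem exists_pow_mul_norm_integral_le {K : Set (RSp n)} (hKΩ : K ⊆ Ω)
    (j : Fin n) (k : ℕ) :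
    ∀ (b : RSp n × RSp n → ℂ), ContDiffOn ℝ ∞ b ((Ω : Set (RSp n)) ×ˢ univ) →
      (∀ i : ℕ, ∃ C, ∀ x ∈ K, ∀ ξ, ‖(partialX j)^[i] b (x, ξ)‖ ≤ C * m ξ) →
      ∀ ψ : RSp n → ℂ, ContDiff ℝ ∞ ψ → HasCompactSupport ψ → tsupport ψ ⊆ K →
      ∃ C, ∀ ξ, |ξ j| ^ k *
        ‖∫ x, Complex.exp (Complex.I * (⟪x, ξ⟫_ℝ : ℝ)) * (b (x, ξ) * ψ x)‖ ≤ C * m ξ := by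
  induction k with
  | zero =>
    intro b hb hbd ψ hψ hc hs
    obtain ⟨C, hC⟩ := hbd 0
    refine ⟨C * ∫ x, ‖ψ x‖, fun ξ => ?_⟩
    rw [pow_zero, one_mul, mul_right_comm]
    exact norm_integral_expI_mul_symbol_le hψ.continuous hc ξ fun x hx => hC x (hs hx) ξ
  | succ k ih =>
    intro b hb hbd ψ hψ hc hs
    have hψ' : ContDiff ℝ ∞ fun x => fderiv ℝ ψ x (EuclideanSpace.single j (1 : ℝ)) :=
      (hψ.fderiv_right (m := ∞) (by simp)).clm_apply contDiff_const
    have hc' : HasCompactSupport fun x => fderiv ℝ ψ x (EuclideanSpace.single j (1 : ℝ)) :=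
      hc.fderiv_apply ℝ _
    have hs' : tsupport (fun x => fderiv ℝ ψ x (EuclideanSpace.single j (1 : ℝ))) ⊆ K :=
      (tsupport_fderiv_apply_subset ℝ _).trans hs
    -- One factor ξ_j is traded for a derivative in x_j, which falls on b or on ψ. Both resulting
    -- integrals have the original form with the same weight m, which is why the induction
    -- quantifies over b and ψ.
    obtain ⟨C₁, h₁⟩ := ih (partialX j b) (contDiffOn_partialX hb j) (fun i => hbd (i + 1))
      ψ hψ hc hs
    obtain ⟨C₂, h₂⟩ := ih b hb hbd _ hψ' hc' hs'
    refine ⟨C₁ + C₂, fun ξ => ?_⟩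
    have hg := contDiff_symbol_mul_section hb hψ (hs.trans hKΩ) ξ
    have key := mul_integral_expI_mul hg hc.mul_left ξ j
    simp_rw [fderiv_symbol_mul_section hb hψ (hs.trans hKΩ) ξ, mul_add] at key
    rw [integral_add (integrable_expI_mul (contDiff_symbol_mul_section (contDiffOn_partialX hb j)
        hψ (hs.trans hKΩ) ξ).continuous hc.mul_left ξ)
      (integrable_expI_mul (contDiff_symbol_mul_section hb hψ' (hs'.trans hKΩ) ξ).continuous
        hc'.mul_left ξ)] at key
    have hn := congrArg norm key
    rw [norm_mul, norm_mul, Complex.norm_I, one_mul, Complex.norm_real, Real.norm_eq_abs,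
      norm_neg] at hn
    rw [pow_succ, mul_assoc, hn, add_mul]
    refine (mul_le_mul_of_nonneg_left (norm_add_le _ _) (by positivity)).trans ?_
    rw [mul_add]
    exact add_le_add (h₁ ξ) (h₂ ξ)

/-! ### Polynomial bounds and rapid decay of the Fourier integral -/

theorem foldr_iterate_zero {X ι : Type*} (P : ι → X → X) (α : ι → ℕ) (l : List ι)
    (h : ∀ i ∈ l, α i = 0) (b : X) : l.foldr (fun i g => (P i)^[α i] g) b = b := by
  induction l with
  | nil => rfl
  | cons i l ih =>
    rw [List.foldr_cons, h i (by simp), ih fun k hk => h k (by simp [hk])]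
    rfl

theorem foldr_iterate_single {X ι : Type*} [DecidableEq ι] (P : ι → X → X) (j : ι) (k : ℕ)
    (l : List ι) (hl : l.Nodup) (hj : j ∈ l) (b : X) :
    l.foldr (fun i g => (P i)^[(Pi.single j k : ι → ℕ) i] g) b = (P j)^[k] b := by
  induction l with
  | nil => simp at hj
  | cons i l ih =>
    rw [List.nodup_cons] at hl
    rw [List.foldr_cons]
    rcases eq_or_ne i j with rfl | hij
    · rw [foldr_iterate_zero _ _ l fun k hk => Pi.single_eq_of_ne (by grind) _,
        Pi.single_eq_same]
    · rw [ih hl.2 (by grind), Pi.single_eq_of_ne hij, Function.iterate_zero, id]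

/-- With α = 0 the product of the λ_k is 1, so x-derivatives of every order cost only m(ξ). These
are the bounds that the integration by parts consumes. -/
theorem IsSymbol.partialX_bound (ha : IsSymbol Ω m Λ a) {K : Set (RSp n)} (hc : IsCompact K)
    (hK : K ⊆ Ω) (j : Fin n) (i : ℕ) :
    ∃ C, ∀ x ∈ K, ∀ ξ, ‖(partialX j)^[i] a (x, ξ)‖ ≤ C * m ξ := by
  obtain ⟨C, -, h⟩ := ha.bound K hc hK 0 (Pi.single j i)
  refine ⟨C, fun x hx ξ => ?_⟩
  have := h x hx ξ
  rw [multiXi, foldr_iterate_zero _ _ _ (by simp), multiX,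
    foldr_iterate_single _ _ _ _ (List.nodup_finRange n) (List.mem_finRange j)] at this
  simpa using this

theorem IsAdmissibleWeight.exists_pow_bound (hm : IsAdmissibleWeight Λ m) :
    ∃ (D : ℝ) (k : ℕ), ∀ ξ, m ξ ≤ D * (1 + ‖ξ‖) ^ k := by
  obtain ⟨N, hN, C, hC, c, hc, htemp, -⟩ := hm.bounds
  obtain ⟨k, hk⟩ := exists_nat_ge N
  refine ⟨C * m 0, k, fun ξ => ?_⟩
  have h2 := htemp 0 ξ
  rw [sub_zero] at h2
  have hm0 := hm.pos 0
  refine h2.trans (mul_le_mul_of_nonneg_left ?_ (by positivity))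
  rw [← Real.rpow_natCast]
  exact Real.rpow_le_rpow_of_exponent_le (by linarith [norm_nonneg ξ]) hk

/-- Assembles decay in the separate coordinate directions into decay in the norm of ξ. -/
theorem one_add_norm_pow_le (k : ℕ) :
    ∃ C : ℝ, 0 ≤ C ∧ ∀ ξ : RSp n, (1 + ‖ξ‖) ^ k ≤ C * (1 + ∑ j, |ξ j| ^ k) := by
  refine ⟨(n + 1 : ℝ) ^ k, by positivity, fun ξ => ?_⟩
  -- Here t = max(1, max_j |ξ_j|): each of the n + 1 terms of 1 + ∑ |ξ_j| is at most t, and t ^ k is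
  -- one of the terms on the right.
  obtain ⟨t, ht, h1, h2⟩ : ∃ t : ℝ, 0 ≤ t ∧ 1 + ‖ξ‖ ≤ (n + 1 : ℝ) * t ∧
      t ^ k ≤ 1 + ∑ j, |ξ j| ^ k := by
    have hsum : ‖ξ‖ ≤ ∑ j, |ξ j| := by
      have := norm_sum_le Finset.univ fun j => EuclideanSpace.single j (ξ j)
      have h : ∑ j, EuclideanSpace.single j (ξ j) = ξ := by
        ext i
        simp [Finset.sum_apply, Pi.single_apply]
      rw [h] at this
      simpa using this
    by_cases hall : ∀ j, |ξ j| ≤ 1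
    · refine ⟨1, zero_le_one, ?_, ?_⟩
      · have : ∑ j, |ξ j| ≤ ∑ _j : Fin n, (1 : ℝ) := Finset.sum_le_sum fun j _ => hall j
        simp at this
        linarith
      · rw [one_pow]
        have : 0 ≤ ∑ j, |ξ j| ^ k := by positivity
        linarith
    · push Not at hall
      obtain ⟨i, hi⟩ := hall
      obtain ⟨j, -, hj⟩ := Finset.exists_max_image Finset.univ (fun j => |ξ j|) ⟨i, by simp⟩
      refine ⟨|ξ j|, abs_nonneg _, ?_, ?_⟩
      · have : ∑ l, |ξ l| ≤ ∑ _l : Fin n, |ξ j| := Finset.sum_le_sum fun l hl => hj l hl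
        simp at this
        have := hj i (by simp)
        linarith
      · have := Finset.single_le_sum (f := fun j => |ξ j| ^ k) (fun l _ => by positivity)
          (Finset.mem_univ j)
        simp only at this
        linarith
  calc (1 + ‖ξ‖) ^ k ≤ ((n + 1 : ℝ) * t) ^ k := by gcongr
    _ = (n + 1 : ℝ) ^ k * t ^ k := mul_pow _ _ _
    _ ≤ _ := by gcongr

/-- The Fourier integral `ξ ↦ ∫ e^{i x·ξ} a(x, ξ) ψ(x) dx`. -/
def symbolIntegral (a : RSp n × RSp n → ℂ) (ψ : RSp n → ℂ) (ξ : RSp n) : ℂ :=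
  ∫ x, Complex.exp (Complex.I * (⟪x, ξ⟫_ℝ : ℝ)) * (a (x, ξ) * ψ x)

/-- Integration by parts gains any power of 1 + ‖ξ‖ up to a factor m(ξ). That factor is at most
polynomial of some degree N, so gaining N further powers absorbs it. -/
theorem symbolIntegral_decay (hm : IsAdmissibleWeight Λ m) (ha : IsSymbol Ω m Λ a)
    (ψ : 𝓓(Ω, ℂ)) (k : ℕ) :
    ∃ C, ∀ ξ, (1 + ‖ξ‖) ^ k * ‖symbolIntegral a ψ ξ‖ ≤ C := by
  have h : ∀ r : ℕ, ∃ C, ∀ ξ, (1 + ‖ξ‖) ^ r * ‖symbolIntegral a ψ ξ‖ ≤ C * m ξ := by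
    intro r
    have hj := fun j => exists_pow_mul_norm_integral_le ψ.tsupport_subset j r a ha.smooth
      (ha.partialX_bound ψ.hasCompactSupport ψ.tsupport_subset j) ψ ψ.contDiff
      ψ.hasCompactSupport le_rfl
    choose C hC using hj
    obtain ⟨C₀, h₀⟩ : ∃ C, ∀ ξ, ‖symbolIntegral a ψ ξ‖ ≤ C * m ξ := by
      obtain ⟨C, -, h⟩ := ha.bound _ ψ.hasCompactSupport ψ.tsupport_subset 0 0
      refine ⟨C * ∫ x, ‖ψ x‖, fun ξ => ?_⟩
      rw [mul_right_comm]
      refine norm_integral_expI_mul_symbol_le ψ.continuous ψ.hasCompactSupport ξ fun x hx => ?_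
      have := h x hx ξ
      rw [multiXi, foldr_iterate_zero _ _ _ (by simp), multiX,
        foldr_iterate_zero _ _ _ (by simp)] at this
      simpa using this
    obtain ⟨D, hD, hpow⟩ := one_add_norm_pow_le (n := n) r
    refine ⟨D * (C₀ + ∑ j, C j), fun ξ => ?_⟩
    calc _ ≤ D * (1 + ∑ j, |ξ j| ^ r) * ‖symbolIntegral a ψ ξ‖ :=
          mul_le_mul_of_nonneg_right (hpow ξ) (norm_nonneg _)
      _ = D * (‖symbolIntegral a ψ ξ‖ + ∑ j, |ξ j| ^ r * ‖symbolIntegral a ψ ξ‖) := by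
          rw [mul_assoc, add_mul, one_mul, Finset.sum_mul]
      _ ≤ D * (C₀ * m ξ + ∑ j, C j * m ξ) := by
          exact mul_le_mul_of_nonneg_left
            (add_le_add (h₀ ξ) (Finset.sum_le_sum fun j _ => hC j ξ)) hD
      _ = _ := by rw [← Finset.sum_mul]; ring
  obtain ⟨D, N, hD⟩ := hm.exists_pow_bound
  obtain ⟨C, hC⟩ := h (k + N)
  refine ⟨|C| * D, fun ξ => ?_⟩
  have hpos : 0 < (1 + ‖ξ‖) ^ N := by positivity
  refine le_of_mul_le_mul_right ?_ hpos
  calc _ = (1 + ‖ξ‖) ^ (k + N) * ‖symbolIntegral a ψ ξ‖ := by ring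
    _ ≤ C * m ξ := hC ξ
    _ ≤ |C| * m ξ := mul_le_mul_of_nonneg_right (le_abs_self C) (hm.pos ξ).le
    _ ≤ |C| * (D * (1 + ‖ξ‖) ^ N) := by gcongr; exact hD ξ
    _ = _ := by ring

theorem continuous_expI_mul_symbol (ha : IsSymbol Ω m Λ a) (ψ : 𝓓(Ω, ℂ)) :
    Continuous fun z : RSp n × RSp n =>
      Complex.exp (Complex.I * (⟪z.1, z.2⟫_ℝ : ℝ)) * (a z * ψ z.1) := by
  have := (contDiff_symbol_mul ha.smooth ψ.contDiff ψ.tsupport_subset).continuous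
  fun_prop

theorem continuous_symbolIntegral (ha : IsSymbol Ω m Λ a) (ψ : 𝓓(Ω, ℂ)) :
    Continuous (symbolIntegral a ψ) := by
  have hF : Continuous (Function.uncurry fun (ξ x : RSp n) =>
      Complex.exp (Complex.I * (⟪x, ξ⟫_ℝ : ℝ)) * (a (x, ξ) * ψ x)) := by
    simp only [Function.uncurry_def]
    have h := (continuous_expI_mul_symbol ha ψ).comp
      ((continuous_snd : Continuous (Prod.snd : RSp n × RSp n → RSp n)).prodMk continuous_fst)
    simpa only [Function.comp_def] using h
  have h := continuous_parametric_integral_of_continuous (μ := (volume : Measure (RSp n))) hF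
    (s := tsupport ψ) ψ.hasCompactSupport
  refine h.congr fun ξ => ?_
  refine setIntegral_eq_integral_of_forall_compl_eq_zero fun x hx => ?_
  rw [image_eq_zero_of_notMem_tsupport hx, mul_zero, mul_zero]

theorem integrable_pow_mul_symbolIntegral (hm : IsAdmissibleWeight Λ m) (ha : IsSymbol Ω m Λ a)
    (ψ : 𝓓(Ω, ℂ)) (k : ℕ) : Integrable fun ξ => ‖ξ‖ ^ k * ‖symbolIntegral a ψ ξ‖ := by
  -- The n + 1 extra powers leave the factor (1 + ‖ξ‖)^{-(n+1)}, which is integrable on ℝⁿ.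
  obtain ⟨C, hC⟩ := symbolIntegral_decay hm ha ψ (k + (n + 1))
  have hint := (integrable_one_add_norm (μ := (volume : Measure (RSp n))) (r := (n + 1 : ℕ))
    (by simp)).const_mul C
  refine hint.mono' ?_ (ae_of_all _ fun ξ => ?_)
  · have := continuous_symbolIntegral ha ψ
    exact Continuous.aestronglyMeasurable (by fun_prop)
  · rw [Real.norm_of_nonneg (by positivity), Real.rpow_neg (by positivity), Real.rpow_natCast,
      ← div_eq_mul_inv, le_div_iff₀ (by positivity)]
    refine le_trans ?_ (hC ξ)
    calc _ ≤ (1 + ‖ξ‖) ^ k * ‖symbolIntegral a ψ ξ‖ * (1 + ‖ξ‖) ^ (n + 1) := by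
          gcongr
          linarith
      _ = _ := by ring

/-! ### The transpose and the formal adjoint -/

/-- The transpose `y ↦ (2π)^{-n} ∫ e^{-i y·ξ} (∫ e^{i x·ξ} a(x, ξ) ψ(x) dx) dξ` of `a(x, D)`
applied to `ψ`. -/
def transposePdo (a : RSp n × RSp n → ℂ) (ψ : RSp n → ℂ) (y : RSp n) : ℂ :=
  (((2 * Real.pi) ^ n : ℝ) : ℂ)⁻¹ * hat (symbolIntegral a ψ) y

/-- All moments of `symbolIntegral a ψ` are integrable, so its Fourier transform may be
differentiated under the integral any number of times. The dilation by (2π)⁻¹ only reconciles two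
normalisations of the transform. -/
theorem contDiff_transposePdo (hm : IsAdmissibleWeight Λ m) (ha : IsSymbol Ω m Λ a)
    (ψ : 𝓓(Ω, ℂ)) : ContDiff ℝ ∞ (transposePdo a ψ) := by
  have h1 : ContDiff ℝ ∞ (FourierTransform.fourier (symbolIntegral a ψ)) :=
    Real.contDiff_fourier (N := ⊤) fun k _ => integrable_pow_mul_symbolIntegral hm ha ψ k
  have h2 : hat (symbolIntegral a ψ) =
      fun y => FourierTransform.fourier (symbolIntegral a ψ) ((2 * Real.pi)⁻¹ • y) := by
    funext y
    rw [Real.fourier_eq']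
    refine integral_congr_ae (ae_of_all _ fun ξ => ?_)
    have hp : (-2 * Real.pi * ⟪ξ, (2 * Real.pi)⁻¹ • y⟫_ℝ : ℝ) = - ⟪ξ, y⟫_ℝ := by
      rw [inner_smul_right]
      field_simp
    simp only [hp, smul_eq_mul]
    congr 2
    push_cast
    ring
  unfold transposePdo
  rw [h2]
  exact contDiff_const.mul (h1.comp (contDiff_const_smul _))

/-- The integrand in (x, ξ, y) need not be absolutely integrable, since a may grow in ξ. Fubini is
therefore applied twice to double integrals: in (x, ξ), where `hat φ` supplies the decay, and in (ξ,
y), where `symbolIntegral a ψ` does. -/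
theorem integral_pdo_mul (hm : IsAdmissibleWeight Λ m) (ha : IsSymbol Ω m Λ a)
    (φ ψ : 𝓓(Ω, ℂ)) :
    ∫ x in (Ω : Set (RSp n)), pdo a φ x * ψ x = ∫ y, φ y * transposePdo a ψ y := by
  have hψi : Integrable (ψ : RSp n → ℂ) :=
    ψ.continuous.integrable_of_hasCompactSupport ψ.hasCompactSupport
  have hφi : Integrable (φ : RSp n → ℂ) :=
    φ.continuous.integrable_of_hasCompactSupport φ.hasCompactSupport
  have hF1 : Integrable (fun z : RSp n × RSp n =>
      Complex.exp (Complex.I * (⟪z.1, z.2⟫_ℝ : ℝ)) * (a z * ψ z.1) * hat φ z.2) := by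
    obtain ⟨D, k, hD⟩ := ha.exists_pow_bound hm ψ.hasCompactSupport ψ.tsupport_subset
    have hdom : Integrable (fun z : RSp n × RSp n =>
        ‖ψ z.1‖ * (D * ((1 + ‖z.2‖) ^ k * ‖hat φ z.2‖))) :=
      hψi.norm.mul_prod ((integrable_pow_mul_hat φ k).const_mul D)
    refine hdom.mono' ?_ (ae_of_all _ fun z => ?_)
    · exact ((continuous_expI_mul_symbol ha ψ).mul
        ((continuous_hat φ).comp continuous_snd)).aestronglyMeasurable
    · rw [norm_mul, norm_mul, norm_exp_I_mul, one_mul, norm_mul]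
      by_cases hx : z.1 ∈ tsupport ψ
      · calc _ ≤ D * (1 + ‖z.2‖) ^ k * ‖ψ z.1‖ * ‖hat φ z.2‖ := by
              gcongr
              exact hD z.1 hx z.2
          _ = _ := by ring
      · simp [image_eq_zero_of_notMem_tsupport hx]
  have hF2 : Integrable (fun z : RSp n × RSp n =>
      Complex.exp (-(Complex.I * (⟪z.2, z.1⟫_ℝ : ℝ))) * φ z.2 * symbolIntegral a ψ z.1) := by
    have hB : Integrable fun ξ => ‖symbolIntegral a ψ ξ‖ := by
      simpa using integrable_pow_mul_symbolIntegral hm ha ψ 0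
    refine (hB.mul_prod hφi.norm).mono' ?_ (ae_of_all _ fun z => ?_)
    · have := continuous_symbolIntegral ha ψ
      exact Continuous.aestronglyMeasurable (by fun_prop)
    · rw [norm_mul, norm_mul, ← mul_neg, ← Complex.ofReal_neg, norm_exp_I_mul, one_mul, mul_comm]
  rw [setIntegral_eq_integral_of_forall_compl_eq_zero fun x hx => by
    rw [image_eq_zero_of_notMem_tsupport fun h => hx (ψ.tsupport_subset h), mul_zero]]
  calc ∫ x, pdo a φ x * ψ x
      = (((2 * Real.pi) ^ n : ℝ) : ℂ)⁻¹ * ∫ x, ∫ ξ,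
          Complex.exp (Complex.I * (⟪x, ξ⟫_ℝ : ℝ)) * (a (x, ξ) * ψ x) * hat φ ξ := by
        rw [← integral_const_mul]
        refine integral_congr_ae (ae_of_all _ fun x => ?_)
        simp only [pdo]
        rw [mul_assoc, ← integral_mul_const]
        congr 1
        refine integral_congr_ae (ae_of_all _ fun ξ => ?_)
        ring
    _ = (((2 * Real.pi) ^ n : ℝ) : ℂ)⁻¹ * ∫ ξ, ∫ y,
          Complex.exp (-(Complex.I * (⟪y, ξ⟫_ℝ : ℝ))) * φ y * symbolIntegral a ψ ξ := by
        rw [integral_integral_swap hF1]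
        congr 1
        refine integral_congr_ae (ae_of_all _ fun ξ => ?_)
        simp only [integral_mul_const]
        rw [mul_comm]
        rfl
    _ = ∫ y, φ y * transposePdo a ψ y := by
        rw [integral_integral_swap hF2, ← integral_const_mul]
        refine integral_congr_ae (ae_of_all _ fun y => ?_)
        simp only [transposePdo, hat]
        rw [mul_left_comm, ← integral_const_mul (φ y)]
        congr 1
        refine integral_congr_ae (ae_of_all _ fun ξ => ?_)
        simp only [real_inner_comm]
        ring

/-- The transpose of a(x, D) applied to the conjugate of ψ is smooth, but its support is not
controlled directly. Proper support shows that it annihilates every test function vanishing on a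
compact K', so multiplying it by a cutoff equal to 1 on K' leaves all its pairings with test
functions unchanged. -/
theorem exists_formalAdjoint (hm : IsAdmissibleWeight Λ m) (ha : IsSymbol Ω m Λ a)
    (hprop : IsProperlySupported Ω a) (ψ : 𝓓(Ω, ℂ)) :
    ∃ g : 𝓓(Ω, ℂ), ∀ φ : 𝓓(Ω, ℂ), sesq Ω (pdo a φ) ψ = sesq Ω φ g := by
  obtain ⟨K', hK', hK'Ω, -, hvan⟩ := hprop _ ψ.hasCompactSupport ψ.tsupport_subset
  obtain ⟨χ, hχ⟩ := exists_cutoff hK' hK'Ω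
  have hG := contDiff_transposePdo hm ha (conjTest ψ)
  have hsesq : ∀ φ : 𝓓(Ω, ℂ),
      sesq Ω (pdo a φ) ψ = ∫ y, φ y * transposePdo a (conjTest ψ) y := fun φ =>
    integral_pdo_mul hm ha φ (conjTest ψ)
  have hzero : ∀ φ : 𝓓(Ω, ℂ), (∀ y ∈ K', φ y = 0) →
      ∫ y, φ y * transposePdo a (conjTest ψ) y = 0 := by
    intro φ hφ
    rw [← hsesq, sesq, integral_congr_ae (g := fun _ => (0 : ℂ)), integral_zero]
    refine ae_of_all _ fun x => ?_
    by_cases hx : x ∈ tsupport ψ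
    · simp [hvan φ hφ x hx]
    · simp [image_eq_zero_of_notMem_tsupport hx]
  refine ⟨conjTest (cutoffMul χ _ hG), fun φ => ?_⟩
  -- The difference φ - χφ vanishes on K', so φ and χφ have the same pairing; the factor χ is then
  -- moved onto the transpose.
  have h0 := hzero (φ - cutoffMul χ φ φ.contDiff) fun y hy => by simp [hχ y hy]
  have hi : ∀ θ : 𝓓(Ω, ℂ), Integrable fun y => θ y * transposePdo a (conjTest ψ) y := fun θ =>
    (θ.continuous.mul hG.continuous).integrable_of_hasCompactSupport θ.hasCompactSupport.mul_right
  have h1 : ∫ y, φ y * transposePdo a (conjTest ψ) y =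
      ∫ y, cutoffMul χ φ φ.contDiff y * transposePdo a (conjTest ψ) y := by
    rw [← sub_eq_zero, ← integral_sub (hi _) (hi _), ← h0]
    refine integral_congr_ae (ae_of_all _ fun y => ?_)
    simp
    ring
  rw [hsesq, h1, sesq, setIntegral_eq_integral_of_forall_compl_eq_zero fun x hx => by
    rw [image_eq_zero_of_notMem_tsupport fun h => hx (φ.tsupport_subset h), zero_mul]]
  refine integral_congr_ae (ae_of_all _ fun y => ?_)
  simp
  ring

/-- Existence rules out the default value 0 in `formalAdjoint`, so the chosen g satisfies its
defining identity. -/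
theorem sesq_pdo_eq (hm : IsAdmissibleWeight Λ m) (ha : IsSymbol Ω m Λ a)
    (hprop : IsProperlySupported Ω a) (φ ψ : 𝓓(Ω, ℂ)) :
    sesq Ω (pdo a φ) ψ = sesq Ω φ (formalAdjoint Ω a ψ) := by
  have h := exists_formalAdjoint hm ha hprop ψ
  rw [formalAdjoint, dif_pos h]
  exact h.choose_spec φ

end symbols

end MPseudo

end

/-! ### Density, closedness and comparison of the extensions -/

namespace MPseudo

section extensions

variable {n : ℕ} {Ω : Opens (RSp n)} {Λ : Fin n → RSp n → ℝ} {m : RSp n → ℝ}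
  {a : RSp n × RSp n → ℂ} {p : ℝ≥0∞}

theorem sesq_congr {f f' : RSp n → ℂ} (h : f =ᵐ[volume.restrict (Ω : Set (RSp n))] f')
    (g : RSp n → ℂ) : sesq Ω f g = sesq Ω f' g :=
  integral_congr_ae (h.mono fun x hx => by simp only [hx])

theorem coeFn_incl (φ : 𝓓(Ω, ℂ)) :
    ⇑(incl Ω p φ) =ᵐ[volume.restrict (Ω : Set (RSp n))] φ :=
  LpLoc.coeFn_ofContinuousOn _ φ.continuous.continuousOn

theorem sesq_incl (φ ψ : 𝓓(Ω, ℂ)) : sesq Ω (incl Ω p φ) ψ = sesq Ω φ ψ :=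
  sesq_congr (coeFn_incl φ) ψ

theorem sesq_pdoLp (hm : IsAdmissibleWeight Λ m) (ha : IsSymbol Ω m Λ a) (φ ψ : 𝓓(Ω, ℂ)) :
    sesq Ω (pdoLp hm ha p φ) ψ = sesq Ω (pdo a φ) ψ :=
  sesq_congr (LpLoc.coeFn_ofContinuousOn _ (continuousOn_pdo hm ha φ)) ψ

variable [Fact (1 ≤ p)]

/-- Makes u ↦ (u, g) a continuous linear functional and translates between the sesquilinear pairing
of adjoints and the bilinear pairing of duals. -/
theorem sesq_eq_testFunctional (u : LpLoc Ω p) (g : 𝓓(Ω, ℂ)) :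
    sesq Ω u g = testFunctional p (conjTest g) u := rfl

/-- Test functions are dense in `L^p_loc(Ω)` for finite `p`. -/
theorem denseRange_incl (hp : p ≠ ⊤) : DenseRange (incl Ω p) := by
  intro u
  rw [mem_closure_iff_nhds_basis (LpLoc.withSeminorms.hasBasis_ball (x := u))]
  rintro ⟨s, r⟩ hr
  -- A basic neighbourhood involves finitely many compact sets; their union K reduces the
  -- approximation to one set.
  obtain ⟨K, hK⟩ : ∃ K : {K : Compacts (RSp n) // (K : Set (RSp n)) ⊆ Ω},
      ∀ L ∈ s, (L.1 : Set (RSp n)) ⊆ K.1 := by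
    refine ⟨⟨s.sup Subtype.val, ?_⟩, fun L hL => ?_⟩
    · rw [Compacts.coe_finset_sup]
      exact Finset.sup_le fun L _ => L.2
    · exact Finset.le_sup (f := Subtype.val) hL
  have hu : MemLp ((K.1 : Set (RSp n)).indicator u) p volume :=
    (memLp_indicator_iff_restrict K.1.isCompact.measurableSet).2 (u.memLp K.1.isCompact K.2)
  -- u, extended by zero off K, is approximated in L^p(ℝⁿ) by a smooth g; this needs p < ∞. The
  -- support of g may leave Ω, so g is multiplied by a cutoff equal to 1 on K. The choice r / 2
  -- turns the non-strict estimate into a strict one.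
  obtain ⟨g, -, hg, hgle⟩ := hu.exist_eLpNorm_sub_le hp Fact.out (ε := r / 2) (half_pos hr)
  obtain ⟨χ, hχ⟩ := exists_cutoff K.1.isCompact K.2
  refine ⟨_, mem_range_self (cutoffMul χ g hg), ?_⟩
  rw [Seminorm.mem_ball]
  refine Seminorm.finset_sup_apply_lt hr fun L hL => ?_
  change (eLpNorm ⇑(incl Ω p (cutoffMul χ g hg) - u) p
    (volume.restrict (L.1 : Set (RSp n)))).toReal < r
  have hsub : ⇑(incl Ω p (cutoffMul χ g hg) - u) =ᵐ[volume.restrict (Ω : Set (RSp n))]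
      fun x => incl Ω p (cutoffMul χ g hg) x - u x := AEEqFun.coeFn_sub _ _
  have hae : ⇑(incl Ω p (cutoffMul χ g hg) - u) =ᵐ[volume.restrict (L.1 : Set (RSp n))]
      g - (K.1 : Set (RSp n)).indicator u := by
    filter_upwards [ae_mono (Measure.restrict_mono L.2 le_rfl) hsub,
      ae_mono (Measure.restrict_mono L.2 le_rfl) (coeFn_incl (p := p) (cutoffMul χ g hg)),
      ae_restrict_mem L.1.isCompact.measurableSet] with x h1 h2 h3
    have hxK := hK L hL h3
    rw [h1, h2, cutoffMul_apply, hχ x hxK, one_mul, Pi.sub_apply, indicator_of_mem hxK]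
  rw [eLpNorm_congr_ae hae, eLpNorm_sub_comm]
  calc _ ≤ (ENNReal.ofReal (r / 2)).toReal :=
        ENNReal.toReal_mono ENNReal.ofReal_ne_top
          ((eLpNorm_mono_measure _ Measure.restrict_le_self).trans hgle)
    _ < r := by rw [ENNReal.toReal_ofReal (half_pos hr).le]; exact half_lt_self hr

/-- For each test function the defining condition equates two continuous functionals of the pair (u,
f), so the graph is an intersection of closed sets. -/
theorem isClosed_maximalExtension : (maximalExtension Ω a p).IsClosed := by
  rw [LinearPMap.IsClosed, graph_maximalExtension]
  have h : (maximalGraph Ω a p : Set (LpLoc Ω p × LpLoc Ω p)) = ⋂ φ : 𝓓(Ω, ℂ),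
      {w | testFunctional p (conjTest (formalAdjoint Ω a φ)) w.1 =
        testFunctional p (conjTest φ) w.2} := by
    ext w
    simp only [mem_iInter]
    rfl
  rw [h]
  exact isClosed_iInter fun φ => isClosed_eq
    ((testFunctional p _).continuous.comp continuous_fst)
    ((testFunctional p _).continuous.comp continuous_snd)

theorem sesq_maximalExtension (u : (maximalExtension Ω a p).domain) (φ : 𝓓(Ω, ℂ)) :
    sesq Ω (u : LpLoc Ω p) (formalAdjoint Ω a φ) = sesq Ω (maximalExtension Ω a p u) φ := by
  have h := (maximalExtension Ω a p).mem_graph u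
  rw [graph_maximalExtension] at h
  exact h φ

theorem testFunctionsInDualDomain_maximalExtension :
    TestFunctionsInDualDomain (maximalExtension Ω a p) := by
  intro φ
  rw [mem_domain_dualOperator]
  -- The two conjugations pass from (·, ·) to ⟨·, ·⟩ and back: the dual sends φ to the conjugate of
  -- T_a* applied to the conjugate of φ.
  refine ⟨testFunctional p (conjTest (formalAdjoint Ω a (conjTest φ))), fun u => ?_⟩
  rw [← sesq_eq_testFunctional, sesq_maximalExtension, sesq_eq_testFunctional, conjTest_conjTest]

theorem opT_le_maximalExtension (hm : IsAdmissibleWeight Λ m) (ha : IsSymbol Ω m Λ a)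
    (hprop : IsProperlySupported Ω a) : opT hm ha p ≤ maximalExtension Ω a p := by
  refine LinearPMap.le_of_le_graph ?_
  rw [graph_maximalExtension]
  rintro ⟨u, f⟩ h
  rw [LinearPMap.mem_graph_iff] at h
  obtain ⟨⟨_, φ, rfl⟩, rfl, rfl⟩ := h
  intro ψ
  change sesq Ω (incl Ω p φ) _ = sesq Ω (opT hm ha p ⟨incl Ω p φ, _⟩) ψ
  rw [opT_incl, sesq_incl, sesq_pdoLp, sesq_pdo_eq hm ha hprop]

/-- T_a is closable because T_{a,1} is a closed extension of it. Taking closures preserves the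
inclusion, and T_{a,1} is its own closure. -/
theorem minimalExtension_le_maximalExtension (hm : IsAdmissibleWeight Λ m)
    (ha : IsSymbol Ω m Λ a) (hprop : IsProperlySupported Ω a) :
    minimalExtension hm ha p ≤ maximalExtension Ω a p := by
  have hc : (maximalExtension Ω a p).IsClosed := isClosed_maximalExtension
  have h := hc.isClosable.closure_mono (opT_le_maximalExtension hm ha hprop)
  refine h.trans (LinearPMap.le_of_le_graph ?_)
  rw [← hc.isClosable.graph_closure_eq_closure_graph]
  exact Submodule.topologicalClosure_minimal _ le_rfl hc

theorem le_maximalExtension (hm : IsAdmissibleWeight Λ m) (ha : IsSymbol Ω m Λ a)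
    (hprop : IsProperlySupported Ω a) (hp : p ≠ ⊤) {B : LpLoc Ω p →ₗ.[ℂ] LpLoc Ω p}
    (hB : opT hm ha p ≤ B) (hdual : TestFunctionsInDualDomain B) :
    B ≤ maximalExtension Ω a p := by
  refine LinearPMap.le_of_le_graph ?_
  rw [graph_maximalExtension]
  rintro ⟨u, f⟩ h
  rw [LinearPMap.mem_graph_iff] at h
  obtain ⟨v, rfl, rfl⟩ := h
  intro ψ
  obtain ⟨x', hx'⟩ := (mem_domain_dualOperator B _).1 (hdual (conjTest ψ))
  -- Both functionals are continuous, so comparing them on the dense test functions suffices. There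
  -- B coincides with T_a, and the adjoint identity gives the value.
  have hx : x' = testFunctional p (conjTest (formalAdjoint Ω a ψ)) := by
    refine ContinuousLinearMap.ext fun w => ?_
    refine congrFun ((denseRange_incl hp).equalizer x'.continuous
      (testFunctional p _).continuous (funext fun φ => ?_)) w
    have hφ := (hB.2 (x := ⟨incl Ω p φ, LinearMap.mem_range_self _ φ⟩)
      (y := ⟨incl Ω p φ, hB.1 (LinearMap.mem_range_self _ φ)⟩) rfl)
    rw [opT_incl] at hφ
    have h1 := hx' ⟨incl Ω p φ, hB.1 (LinearMap.mem_range_self _ φ)⟩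
    rw [← hφ, ← sesq_eq_testFunctional, sesq_pdoLp, sesq_pdo_eq hm ha hprop,
      ← sesq_incl (p := p), sesq_eq_testFunctional] at h1
    exact h1.symm
  change sesq Ω (v : LpLoc Ω p) _ = sesq Ω (B v) ψ
  -- The formula for x' was derived from test functions only, whereas `hx'` holds on all of D(B);
  -- together they give the identity at v.
  rw [sesq_eq_testFunctional, sesq_eq_testFunctional, hx' v, hx]

end extensions

end MPseudo


theorem proposition3p4 {n : ℕ} (Ω : Opens (RSp n)) (p : ℝ≥0∞) [Fact (1 ≤ p)]
    (hp₁ : 1 < p) (hp₂ : p < ⊤)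
    (Λ : Fin n → RSp n → ℝ) (hΛ : IsWeightVector Λ)
    (m : RSp n → ℝ) (hm : IsAdmissibleWeight Λ m) (hmc : ∃ c > (0 : ℝ), ∀ ξ, c ≤ m ξ)
    (a : RSp n × RSp n → ℂ) (ha : IsSymbol Ω m Λ a) (hprop : IsProperlySupported Ω a) :
    TestFunctionsInDualDomain (maximalExtension Ω a p) ∧
    minimalExtension hm ha p ≤ maximalExtension Ω a p ∧
    IsGreatest
      {B : LpLoc Ω p →ₗ.[ℂ] LpLoc Ω p |
        opT hm ha p ≤ B ∧ B.IsClosed ∧ TestFunctionsInDualDomain B}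
      (maximalExtension Ω a p) := by
  have hclosed : (maximalExtension Ω a p).IsClosed := isClosed_maximalExtension
  have hdual : TestFunctionsInDualDomain (maximalExtension Ω a p) :=
    testFunctionsInDualDomain_maximalExtension
  exact ⟨hdual, minimalExtension_le_maximalExtension hm ha hprop,
    ⟨opT_le_maximalExtension hm ha hprop, hclosed, hdual⟩,
    fun B hB => le_maximalExtension hm ha hprop hp₂.ne hB.1 hB.2.2⟩
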